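/- Let $\alpha\in(0,\infty)$ and let $\mathcal M\subset\mathbb R^{n+1}$ be a smooth, $n$-dimensional, closed (compact, without boundary), connected embedded hypersurface, and let $h$ be the metric induced on $\mathcal M$ by the Euclidean metric. Let $\hat x_\alpha:\mathcal M\times[0,T)\to\mathbb R^{n+1}$ be a time-dependent embedding ($\hat x_\alpha(t)$ is an embedding of class $C^2$ for every $t\in[0,T)$, and $\hat x_\alpha$ is differentiable in $t$, one-sidedly at $t=0$) which solves $$\big(\alpha\hat\rho\,\mathbb 1+(1-\alpha\hat\rho)\,(\nu\circ\hat x_\alpha)\otimes(\nu\circ\hat x_\alpha)\big)\,\partial_t\hat x_\alpha=\Delta_{\hat g_\alpha(t)}\hat x_\alpha+\hat\rho\,(P\circ\hat x_\alpha)\,\Delta_h\hat x_\alpha .$$ Here $\hat g_\alpha(t)$ is the metric on $\mathcal M$ induced by $\hat x_\alpha(t)$; $\Delta_g$ is the Laplace operator of the metric $g$, given in local coordinates by $\Delta_g f=g^{ij}(\partial_i\partial_j f-\Gamma(g)^k_{ij}\partial_k f)$ and applied componentwise; $\hat\rho=\sqrt{\det(h_{ij})}/\sqrt{\det(\hat g_{\alpha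 ij})}$; $\nu$ is a unit normal field to $\Gamma(t):=\hat x_\alpha(\mathcal M,t)$; and $P=\mathbb 1-\nu\otimes\nu$. For $f:\Gamma(t)\to\mathbb R^{n+1}$ let $\nabla_{\Gamma(t)}f$ be its tangential gradient, the matrix with entries $(\nabla_{\Gamma(t)}f)_{\beta\gamma}=\underline D_\gamma f_\beta$, where $\underline D_\gamma f$ is the derivative of $f$ in the direction $Pe_\gamma$. For a time-dependent function $f$ on $\Gamma(t)$ let $\partial^\bullet f$ be the material derivative, $(\partial^\bullet f)\circ\hat x_\alpha=\partial_t(f\circ\hat x_\alpha)$. Let $$\hat H_\alpha(t):=(\nabla_{\Gamma(t)}\hat x_\alpha^{-1}(t))^T\,\nabla_{\Gamma(t)}\hat x_\alpha^{-1}(t)+\nu(t)\otimes\nu(t)\quad\text{on }\Gamma(t).$$ Let $d\sigma$ be the $n$-dimensional Hausdorff measure on $\Gamma(t)$, and let $H^{1,2}(\Gamma(t),\mathbb R^{n+1})$ be the closure of $C^1(\Gamma(t),\mathbb R^{n+1})$ in the norm $\|\eta\|_{L^2}+\|\nabla_{\Gamma(t)}\eta\|_{L^2}$. Then, for every $t\in[0,T)$,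 the weight $\rho:=\hat\rho\circ\hat x_\alpha^{-1}$ is given by $\rho=\sqrt{\det\hat H_\alpha}$, and the identity map $u:=\mathrm{id}_{\Gamma(t)}$ satisfies, for every $\eta\in H^{1,2}(\Gamma(t),\mathbb R^{n+1})$ (for which also $P\eta\in H^{1,2}(\Gamma(t),\mathbb R^{n+1})$, and all integrands below are integrable), $$\begin{aligned}0={}&\int_{\Gamma(t)}\alpha\rho\,\partial^\bullet u\cdot\eta\,d\sigma+\int_{\Gamma(t)}(1-\alpha\rho)\,(\partial^\bullet u\cdot\nu)(\nu\cdot\eta)\,d\sigma\\&+\int_{\Gamma(t)}\nabla_{\Gamma(t)}u:\nabla_{\Gamma(t)}\eta\,d\sigma+\int_{\Gamma(t)}\hat H_\alpha^{-1}\nabla_{\Gamma(t)}u:\nabla_{\Gamma(t)}(P\eta)\,\rho\,d\sigma ,\end{aligned}$$ where $A:B=\sum_{\beta,\gamma}A_{\beta\gamma}B_{\beta\gamma}$ and $\hat H_\alpha^{-1}\nabla_{\Gamma(t)}u:\nabla_{\Gamma(t)}(P\eta):=\sum_{\beta,\gamma,\kappa}(\hat H_\alpha^{-1})_{\gamma\kappa}\,\underline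 D_\gamma u_\beta\,\underline D_\kappa(P\eta)_\beta$. -/

import Mathlib

open MeasureTheory Set Filter Topology
open scoped ContDiff RealInnerProductSpace

noncomputable section

namespace HypersurfaceFlow

/-- The Euclidean space `ℝᵐ`. -/
abbrev Euc (m : ℕ) : Type := EuclideanSpace ℝ (Fin m)

/-! ### Hypersurfaces of `ℝⁿ⁺¹` and their local parametrizations -/

/-- `X : Ω → N` is (the inverse of) a coordinate chart of class `C^k` of the `n`-dimensional
hypersurface `N ⊆ ℝⁿ⁺¹`: an immersion of class `C^k` of an open set `Ω ⊆ ℝⁿ` that is a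
homeomorphism onto a relatively open subset of `N`. -/
structure IsLocalParam {n : ℕ} (k : WithTop ℕ∞) (N : Set (Euc (n + 1)))
    (Ω : Set (Euc n)) (X : Euc n → Euc (n + 1)) : Prop where
  isOpen_source : IsOpen Ω
  contDiffOn : ContDiffOn ℝ k X Ω
  immersion : ∀ θ ∈ Ω, Function.Injective (fderiv ℝ X θ)
  isEmbedding : IsEmbedding (Ω.domRestrict X)
  isOpen_image : ∃ U : Set (Euc (n + 1)), IsOpen U ∧ X '' Ω = N ∩ U

/-- `N` is an (embedded) `n`-dimensional hypersurface of `ℝⁿ⁺¹` of class `C^k`. -/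
def IsHypersurface {n : ℕ} (k : WithTop ℕ∞) (N : Set (Euc (n + 1))) : Prop :=
  ∀ p ∈ N, ∃ (Ω : Set (Euc n)) (X : Euc n → Euc (n + 1)), IsLocalParam k N Ω X ∧ p ∈ X '' Ω

/-- `ν` is a unit normal field to the hypersurface `N`. (All the notions below depend on `ν` only
up to sign.) -/
def IsUnitNormal {n : ℕ} (N : Set (Euc (n + 1))) (ν : Euc (n + 1) → Euc (n + 1)) : Prop :=
  (∀ p ∈ N, ‖ν p‖ = 1) ∧
    ∀ (Ω : Set (Euc n)) (X : Euc n → Euc (n + 1)), IsLocalParam 1 N Ω X →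
      ∀ θ ∈ Ω, ∀ v : Euc n, ⟪fderiv ℝ X θ v, ν (X θ)⟫ = 0

/-- `y` is an embedding of class `C^k` of the smooth hypersurface `M` into `ℝⁿ⁺¹`: an immersion
which is a homeomorphism onto its image. -/
structure IsEmbeddingOn {n : ℕ} (k : WithTop ℕ∞) (M : Set (Euc (n + 1)))
    (y : Euc (n + 1) → Euc (n + 1)) : Prop where
  contDiffOn : ContDiffOn ℝ k y M
  immersion : ∀ (Ω : Set (Euc n)) (X : Euc n → Euc (n + 1)), IsLocalParam ∞ M Ω X →
    ∀ θ ∈ Ω, Function.Injective (fderiv ℝ (y ∘ X) θ)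
  isEmbedding : IsEmbedding (M.domRestrict y)

/-! ### Metrics and Laplacians in local coordinates -/

/-- The partial derivative `∂F/∂θⁱ`. -/
def pd {n : ℕ} {W : Type*} [NormedAddCommGroup W] [NormedSpace ℝ W] (i : Fin n)
    (F : Euc n → W) (θ : Euc n) : W :=
  fderiv ℝ F θ (EuclideanSpace.single i 1)

/-- The components `∂F/∂θⁱ · ∂F/∂θʲ` of the metric induced by `F`. -/
def inducedMetric {n m : ℕ} (F : Euc n → Euc m) (θ : Euc n) : Matrix (Fin n) (Fin n) ℝ :=
  Matrix.of fun i j => ⟪pd i F θ, pd j F θ⟫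

/-- The Christoffel symbol `Γ(g)ᵏᵢⱼ`. -/
def christoffel {n : ℕ} (g : Euc n → Matrix (Fin n) (Fin n) ℝ) (k i j : Fin n) (θ : Euc n) : ℝ :=
  (1 / 2) * ∑ l, (g θ)⁻¹ k l *
    (pd i (fun ϑ => g ϑ l j) θ + pd j (fun ϑ => g ϑ l i) θ - pd l (fun ϑ => g ϑ i j) θ)

/-- The Laplace operator of the metric `g` in local coordinates,
`gⁱʲ (∂²F/∂θⁱ∂θʲ - Γ(g)ᵏᵢⱼ ∂F/∂θᵏ)`. -/
def laplacian {n m : ℕ} (g : Euc n → Matrix (Fin n) (Fin n) ℝ) (F : Euc n → Euc m)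
    (θ : Euc n) : Euc m :=
  ∑ i, ∑ j, (g θ)⁻¹ i j • (pd i (pd j F) θ - ∑ k, christoffel g k i j θ • pd k F θ)

/-- `√det h / √det ĝ` for the metrics `h`, `ĝ` induced by `X` and by `F`, respectively. -/
def volumeRatio {n m m' : ℕ} (X : Euc n → Euc m) (F : Euc n → Euc m') (θ : Euc n) : ℝ :=
  √(inducedMetric X θ).det / √(inducedMetric F θ).det

/-! ### The flow -/

/-- The projection `P = 1 - ν ⊗ ν`, for a unit vector `ν`. -/
def proj {m : ℕ} (ν v : Euc m) : Euc m := v - ⟪ν, v⟫ • ν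

/-- The family `x̂(t)`, `t ∈ [0, T)`, of `C²` embeddings of `M` (with `ν t` a unit normal field to
`x̂(t)(M)`) solves
`(α ρ̂ 1 + (1 - α ρ̂) (ν ∘ x̂) ⊗ (ν ∘ x̂)) ∂ₜ x̂ = Δ_ĝ x̂ + ρ̂ (P ∘ x̂) Δ_h x̂`,
where `h` is the metric induced on `M` by the ambient space, `ĝ` is the metric induced by `x̂`, and
`ρ̂ = √det h / √det ĝ`. -/
structure SolvesVariantFlow {n : ℕ} (α : ℝ) (M : Set (Euc (n + 1))) (T : ℝ)
    (x : ℝ → Euc (n + 1) → Euc (n + 1)) (ν : ℝ → Euc (n + 1) → Euc (n + 1)) : Prop where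
  isEmbeddingOn : ∀ t ∈ Ico 0 T, IsEmbeddingOn 2 M (x t)
  isUnitNormal : ∀ t ∈ Ico 0 T, IsUnitNormal (x t '' M) (ν t)
  differentiable_time : ∀ p ∈ M, DifferentiableOn ℝ (fun t => x t p) (Ico 0 T)
  equation : ∀ t ∈ Ico 0 T, ∀ (Ω : Set (Euc n)) (X : Euc n → Euc (n + 1)),
    IsLocalParam ∞ M Ω X → ∀ θ ∈ Ω,
      let X' : Euc n → Euc (n + 1) := fun ϑ => x t (X ϑ)
      let xt : Euc (n + 1) := derivWithin (fun s => x s (X θ)) (Ico 0 T) t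
      let N : Euc (n + 1) := ν t (X' θ)
      let r : ℝ := volumeRatio X X' θ
      (α * r) • xt + (1 - α * r) • (⟪N, xt⟫ • N) =
        laplacian (inducedMetric X') X' θ + r • proj N (laplacian (inducedMetric X) X' θ)

/-- The material derivative `(∂•f) ∘ x̂ = ∂ₜ (f ∘ x̂)` at time `t`, as a function on `x̂(t)(M)`. -/
def materialDeriv {n : ℕ} (M : Set (Euc (n + 1))) (T : ℝ)
    (x : ℝ → Euc (n + 1) → Euc (n + 1)) (f : ℝ → Euc (n + 1) → Euc (n + 1)) (t : ℝ)
    (q : Euc (n + 1)) : Euc (n + 1) :=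
  derivWithin (fun s => f s (x s (Function.invFunOn (x t) M q))) (Ico 0 T) t

/-! ### Tangential gradients and the Sobolev space `H^{1,2}` -/

/-- The tangential gradient of `f : N → ℝⁿ⁺¹`, as the matrix with entries `(β, γ) ↦ D_γ f_β`. The
derivative of `f` within `N` at `q` (equivalently, the derivative of an extension of `f` that is
differentiable at `q`) is only determined on vectors tangent to `N`; it is applied to `P e_γ`. -/
def tangGrad {n : ℕ} (N : Set (Euc (n + 1))) (ν f : Euc (n + 1) → Euc (n + 1))
    (q : Euc (n + 1)) : Matrix (Fin (n + 1)) (Fin (n + 1)) ℝ :=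
  Matrix.of fun β γ => (fderivWithin ℝ f N q (proj (ν q) (EuclideanSpace.single γ 1))) β

/-- The surface measure `dσ` of the hypersurface `N`: the (normalized) `n`-dimensional Hausdorff
measure. -/
def surf {n : ℕ} (N : Set (Euc (n + 1))) : Measure (Euc (n + 1)) :=
  (μHE[n] : Measure (Euc (n + 1))).restrict N

/-- `η` belongs to the Sobolev space `H^{1,2}(N, ℝⁿ⁺¹)`, the closure of `C¹(N, ℝⁿ⁺¹)` in the
norm `‖η‖_{L²} + ‖∇_N η‖_{L²}`, and `G` represents its tangential gradient `∇_N η`. -/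
def HasSobolevGrad {n : ℕ} (N : Set (Euc (n + 1))) (ν η : Euc (n + 1) → Euc (n + 1))
    (G : Euc (n + 1) → Matrix (Fin (n + 1)) (Fin (n + 1)) ℝ) : Prop :=
  MemLp η 2 (surf N) ∧ (∀ β γ, MemLp (fun q => G q β γ) 2 (surf N)) ∧
    ∃ φ : ℕ → Euc (n + 1) → Euc (n + 1),
      (∀ k, ContDiffOn ℝ 1 (φ k) N) ∧
      Tendsto (fun k => eLpNorm (fun q => φ k q - η q) 2 (surf N)) atTop (𝓝 0) ∧
      ∀ β γ, Tendsto (fun k => eLpNorm (fun q => tangGrad N ν (φ k) q β γ - G q β γ) 2 (surf N))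
        atTop (𝓝 0)

/-! ### The matrix field `Ĥ` and the contractions in the weak formulation -/

/-- `Ĥ = (∇_Γ x̂⁻¹)ᵀ ∇_Γ x̂⁻¹ + ν ⊗ ν` on `Γ = y(M)`, for the embedding `y = x̂(t)`. -/
def HMat {n : ℕ} (M : Set (Euc (n + 1))) (y ν : Euc (n + 1) → Euc (n + 1))
    (q : Euc (n + 1)) : Matrix (Fin (n + 1)) (Fin (n + 1)) ℝ :=
  (tangGrad (y '' M) ν (Function.invFunOn y M) q).transpose *
      tangGrad (y '' M) ν (Function.invFunOn y M) q +
    Matrix.of fun β γ => ν q β * ν q γ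

/-- The matrix scalar product `A : B`. -/
def dotdot {m : ℕ} (A B : Matrix (Fin m) (Fin m) ℝ) : ℝ := ∑ β, ∑ γ, A β γ * B β γ

/-- `K A : B = ∑ K_{γκ} A_{βγ} B_{βκ}`, so that
`K ∇u : ∇w = ∑ K_{γκ} D_γ u_β D_κ w_β`. -/
def dotdotWith {m : ℕ} (K A B : Matrix (Fin m) (Fin m) ℝ) : ℝ :=
  ∑ γ, ∑ κ, ∑ β, K γ κ * A β γ * B β κ

end HypersurfaceFlow

end

open HypersurfaceFlow

/-! Fix `t` and write `y = x t`, `Γ = y '' M`. In a chart `X` of `M`, put `Y = y ∘ X`, with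
Jacobians `A` of `X` and `B` of `Y`, so that `h = AᵀA` and `g = BᵀB`. A tangential gradient on `Γ`
is the Jacobian of the pulled-back field times `g⁻¹Bᵀ` (`tangGrad_param`), hence `Ĥ = B g⁻¹ h g⁻¹ Bᵀ
+ ν ⊗ ν`. Since `B g⁻¹ Bᵀ + ν ⊗ ν = 1`, linear algebra gives `det Ĥ = det h / det g` and `Ĥ⁻¹ = B
h⁻¹ Bᵀ + ν ⊗ ν`. The first identity is the formula for `ρ`. The second, together with `ρ √det g =
√det h`, shows that the `Ĥ⁻¹`-weighted integral is the Dirichlet form of `h` written on `Γ`, just as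
the unweighted one is the Dirichlet form of `g`.

Testing the flow equation with `η` produces `Δ_g y · η` and, as `P` is symmetric, `ρ Δ_h y · Pη`.
Each is integrated by parts: in a chart the Laplacian is a divergence (`sum_pd_flux`), the area
formula (`euclideanHausdorffMeasure_image_eq`) transfers the result to Hausdorff measure, and a
partition of unity globalizes it (`integral_sum_cutoffLaplacian_by_parts`,
`exists_laplacian_fields`).

Both formulas are first proved for `C¹` fields. They extend to Sobolev fields because all terms are
linear in the field and its gradient with continuous, hence bounded, coefficients
(`HasSobolevGrad.integral_by_parts`). Multiplication by `P` preserves the Sobolev space because `ν ⊗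
ν = 1 - B g⁻¹ Bᵀ` is `C¹`, whatever the regularity of the chosen `ν` (`contDiffOn_normal_mul`). -/

namespace HypersurfaceFlow

open scoped Matrix

/-! ### Linear algebra of tangential matrices completed by `ν ⊗ ν` -/

section MatrixAlgebra

variable {n : ℕ} {A B : Matrix (Fin (n + 1)) (Fin n) ℝ} {ν : Fin (n + 1) → ℝ}

/-- Completeness: the tangential projection and the normal projection add up to the identity. -/
theorem tangent_add_normal_eq_one (hν : ν ⬝ᵥ ν = 1) (hB : Bᵀ *ᵥ ν = 0)
    (hg : IsUnit (Bᵀ * B).det) :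
    B * (Bᵀ * B)⁻¹ * Bᵀ + Matrix.vecMulVec ν ν = 1 := by
  have hB' : ν ᵥ* B = 0 := by rw [← Matrix.mulVec_transpose, hB]
  -- The rows `(BᵀB)⁻¹Bᵀ` and `ν` form a left inverse of the square block matrix `[B ν]`; being
  -- square, it is also a right inverse, and that product is the claim.
  have key : Matrix.fromRows ((Bᵀ * B)⁻¹ * Bᵀ) (Matrix.replicateRow (Fin 1) ν) *
      Matrix.fromCols B (Matrix.replicateCol (Fin 1) ν) = 1 := by
    rw [Matrix.fromRows_mul_fromCols, Matrix.mul_assoc, Matrix.nonsing_inv_mul _ hg,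
      Matrix.mul_assoc, ← Matrix.replicateCol_mulVec, hB, ← Matrix.replicateRow_vecMul, hB',
      Matrix.replicateRow_mul_replicateCol]
    rw [← Matrix.fromBlocks_one]
    congr 1
    · ext i j; simp [Matrix.mul_apply]
    · ext i j
      rw [Subsingleton.elim i j]
      simp [hν]
  replace key := (Matrix.mul_eq_one_comm_of_equiv finSumFinEquiv).mp key
  rw [Matrix.fromCols_mul_fromRows, ← Matrix.mul_assoc] at key
  rwa [Matrix.vecMulVec_eq (Fin 1)]

/-- By completeness the matrix is `1 + B (K - (BᵀB)⁻¹) Bᵀ`, and `det (1 + UV) = det (1 + VU)`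
reduces to the smaller size. -/
theorem det_tangent_add_normal (hν : ν ⬝ᵥ ν = 1) (hB : Bᵀ *ᵥ ν = 0)
    (hg : IsUnit (Bᵀ * B).det) (K : Matrix (Fin n) (Fin n) ℝ) :
    (B * K * Bᵀ + Matrix.vecMulVec ν ν).det = K.det * (Bᵀ * B).det := by
  have h1 : B * K * Bᵀ + Matrix.vecMulVec ν ν = 1 + B * ((K - (Bᵀ * B)⁻¹) * Bᵀ) := by
    rw [← tangent_add_normal_eq_one hν hB hg]
    simp only [Matrix.sub_mul, Matrix.mul_sub, Matrix.mul_assoc]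
    abel
  rw [h1, Matrix.det_one_add_mul_comm, Matrix.mul_assoc, Matrix.sub_mul,
    Matrix.nonsing_inv_mul _ hg, add_sub_cancel, Matrix.det_mul]

/-- The mixed terms vanish because `Bᵀν = 0`, so the tangential and normal blocks multiply
separately. -/
theorem tangent_add_normal_mul (hν : ν ⬝ᵥ ν = 1) (hB : Bᵀ *ᵥ ν = 0)
    (K L : Matrix (Fin n) (Fin n) ℝ) :
    (B * K * Bᵀ + Matrix.vecMulVec ν ν) * (B * L * Bᵀ + Matrix.vecMulVec ν ν) =
      B * (K * (Bᵀ * B) * L) * Bᵀ + Matrix.vecMulVec ν ν := by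
  have hB' : ν ᵥ* B = 0 := by rw [← Matrix.mulVec_transpose, hB]
  have e1 : Bᵀ * Matrix.vecMulVec ν ν = 0 := by
    rw [Matrix.mul_vecMulVec, hB, Matrix.zero_vecMulVec]
  have e2 : Matrix.vecMulVec ν ν * B = 0 := by
    rw [Matrix.vecMulVec_mul, hB']; ext; simp [Matrix.vecMulVec_apply]
  have e3 : Matrix.vecMulVec ν ν * Matrix.vecMulVec ν ν = Matrix.vecMulVec ν ν := by
    rw [Matrix.vecMulVec_mul_vecMulVec, hν, one_smul]
  simp only [Matrix.add_mul, Matrix.mul_add, Matrix.mul_assoc, e1, e3, Matrix.mul_zero]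
  simp only [← Matrix.mul_assoc, e2, Matrix.zero_mul, zero_add, add_zero]

theorem dotdotWith_eq_trace {m : ℕ} (K E F : Matrix (Fin m) (Fin m) ℝ) :
    dotdotWith K E F = (E * K * Fᵀ).trace := by
  simp only [dotdotWith, Matrix.trace, Matrix.diag, Matrix.mul_apply, Matrix.transpose_apply,
    Finset.sum_mul]
  rw [Finset.sum_congr rfl fun γ _ => Finset.sum_comm, Finset.sum_comm]
  refine Finset.sum_congr rfl fun β _ => ?_
  rw [Finset.sum_comm]
  refine Finset.sum_congr rfl fun κ _ => Finset.sum_congr rfl fun γ _ => ?_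
  ring

theorem dotdot_eq_dotdotWith_one {m : ℕ} (E F : Matrix (Fin m) (Fin m) ℝ) :
    dotdot E F = dotdotWith 1 E F := by
  simp only [dotdotWith_eq_trace, Matrix.mul_one, dotdot, Matrix.trace, Matrix.diag,
    Matrix.mul_apply, Matrix.transpose_apply]

/-- With `B` the Jacobian of a chart `Y` and `C` that of `φ ∘ Y`, the last two arguments are the
tangential gradients of the identity and of `φ`. The normal block of the first argument is
annihilated by `Bᵀ`, and what is left is the coordinate contraction through `L`. -/
theorem dotdotWith_tangent (hB : Bᵀ *ᵥ ν = 0)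
    (hg : IsUnit (Bᵀ * B).det) (L : Matrix (Fin n) (Fin n) ℝ)
    (C : Matrix (Fin (n + 1)) (Fin n) ℝ) :
    dotdotWith (B * L * Bᵀ + Matrix.vecMulVec ν ν) (B * (Bᵀ * B)⁻¹ * Bᵀ)
      (C * (Bᵀ * B)⁻¹ * Bᵀ) = (B * L * Cᵀ).trace := by
  have hB' : ν ᵥ* B = 0 := by rw [← Matrix.mulVec_transpose, hB]
  have e1 : Bᵀ * Matrix.vecMulVec ν ν = 0 := by
    rw [Matrix.mul_vecMulVec, hB, Matrix.zero_vecMulVec]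
  have hgT : ((Bᵀ * B)⁻¹)ᵀ = (Bᵀ * B)⁻¹ := by
    rw [Matrix.transpose_nonsing_inv, Matrix.transpose_mul, Matrix.transpose_transpose]
  rw [dotdotWith_eq_trace]
  congr 1
  rw [Matrix.transpose_mul, Matrix.transpose_mul, hgT, Matrix.transpose_transpose, Matrix.mul_add,
    Matrix.mul_assoc _ Bᵀ (Matrix.vecMulVec ν ν), e1, Matrix.mul_zero, add_zero]
  calc B * (Bᵀ * B)⁻¹ * Bᵀ * (B * L * Bᵀ) * (B * ((Bᵀ * B)⁻¹ * Cᵀ))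
      = B * ((Bᵀ * B)⁻¹ * (Bᵀ * B)) * L * ((Bᵀ * B) * (Bᵀ * B)⁻¹) * Cᵀ := by
        simp only [Matrix.mul_assoc]
    _ = B * L * Cᵀ := by
        rw [Matrix.nonsing_inv_mul _ hg, Matrix.mul_nonsing_inv _ hg, Matrix.mul_one,
          Matrix.mul_one]

/-- The matrix `Ĥ` in terms of the Jacobians `A`, `B` of two parametrizations. -/
theorem hMat_algebra (A : Matrix (Fin (n + 1)) (Fin n) ℝ) :
    (A * (Bᵀ * B)⁻¹ * Bᵀ)ᵀ * (A * (Bᵀ * B)⁻¹ * Bᵀ) =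
      B * ((Bᵀ * B)⁻¹ * (Aᵀ * A) * (Bᵀ * B)⁻¹) * Bᵀ := by
  have hgT : ((Bᵀ * B)⁻¹)ᵀ = (Bᵀ * B)⁻¹ := by
    rw [Matrix.transpose_nonsing_inv, Matrix.transpose_mul, Matrix.transpose_transpose]
  rw [Matrix.transpose_mul, Matrix.transpose_mul, hgT, Matrix.transpose_transpose]
  simp only [Matrix.mul_assoc]

theorem det_hMat_algebra (hν : ν ⬝ᵥ ν = 1) (hB : Bᵀ *ᵥ ν = 0)
    (hg : IsUnit (Bᵀ * B).det) (A : Matrix (Fin (n + 1)) (Fin n) ℝ) :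
    (B * ((Bᵀ * B)⁻¹ * (Aᵀ * A) * (Bᵀ * B)⁻¹) * Bᵀ + Matrix.vecMulVec ν ν).det =
      (Aᵀ * A).det / (Bᵀ * B).det := by
  rw [det_tangent_add_normal hν hB hg, Matrix.det_mul, Matrix.det_mul, Matrix.det_nonsing_inv,
    Ring.inverse_eq_inv']
  have := hg.ne_zero
  field_simp

/-- On the tangential block, `(g⁻¹ h g⁻¹) g h⁻¹ = g⁻¹`, which is the tangential block of the
identity. The metric `h` of the reference surface thereby enters the weighted Dirichlet integral. -/
theorem inv_hMat_algebra (hν : ν ⬝ᵥ ν = 1) (hB : Bᵀ *ᵥ ν = 0)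
    (hg : IsUnit (Bᵀ * B).det) (hh : IsUnit (Aᵀ * A).det) :
    (B * ((Bᵀ * B)⁻¹ * (Aᵀ * A) * (Bᵀ * B)⁻¹) * Bᵀ + Matrix.vecMulVec ν ν)⁻¹ =
      B * (Aᵀ * A)⁻¹ * Bᵀ + Matrix.vecMulVec ν ν := by
  apply Matrix.inv_eq_right_inv
  rw [tangent_add_normal_mul hν hB, ← tangent_add_normal_eq_one hν hB hg]
  congr 3
  rw [Matrix.mul_assoc _ (Bᵀ * B)⁻¹, Matrix.nonsing_inv_mul _ hg, Matrix.mul_one,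
    Matrix.mul_assoc, Matrix.mul_nonsing_inv _ hh, Matrix.mul_one]

end MatrixAlgebra

/-! ### The area formula for injective `C¹` immersions -/

section AreaFormula

open scoped NNReal ENNReal Function

variable {n m : ℕ}

/-- On `h '' E` the map `f` factors through `h` as a `K`-Lipschitz map. Applied with an immersion
and its linearization in both roles. -/
theorem euclideanHausdorffMeasure_image_le_of_dist_le {Z V W : Type*}
    [MetricSpace V] [MeasurableSpace V] [BorelSpace V]
    [MetricSpace W] [MeasurableSpace W] [BorelSpace W]
    (d : ℕ) (K : ℝ≥0) {f : Z → V} {h : Z → W} {E : Set Z}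
    (hfh : ∀ a ∈ E, ∀ b ∈ E, dist (f a) (f b) ≤ K * dist (h a) (h b)) :
    (μHE[d] : Measure V) (f '' E) ≤ (K : ℝ≥0∞) ^ d * (μHE[d] : Measure W) (h '' E) := by
  rcases E.eq_empty_or_nonempty with rfl | ⟨z0, hz0⟩
  · simp
  have : Nonempty Z := ⟨z0⟩
  have hinv : ∀ a ∈ E, Function.invFunOn h E (h a) ∈ E ∧ h (Function.invFunOn h E (h a)) = h a :=
    fun a ha => ⟨Function.invFunOn_mem ⟨a, ha, rfl⟩, Function.invFunOn_eq ⟨a, ha, rfl⟩⟩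
  have hlip : LipschitzOnWith K (f ∘ Function.invFunOn h E) (h '' E) := by
    apply LipschitzOnWith.of_dist_le_mul
    rintro _ ⟨a, ha, rfl⟩ _ ⟨b, hb, rfl⟩
    have := hfh _ (hinv a ha).1 _ (hinv b hb).1
    rwa [(hinv a ha).2, (hinv b hb).2] at this
  have himg : (f ∘ Function.invFunOn h E) '' (h '' E) = f '' E := by
    rw [image_image]
    refine image_congr fun a ha => ?_
    have := hfh _ (hinv a ha).1 _ ha
    rw [(hinv a ha).2, dist_self, mul_zero] at this
    exact dist_le_zero.1 this
  have := hlip.hausdorffMeasure_image_le (d := d) (by positivity)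
  rw [himg, ENNReal.rpow_natCast] at this
  simp only [Measure.euclideanHausdorffMeasure_def, Measure.smul_apply, ENNReal.smul_def, smul_eq_mul]
  calc _ ≤ _ := mul_le_mul_right this _
    _ = _ := by ring

/-- The area element `√det (∂ᵢX · ∂ⱼX)`. -/
noncomputable def areaElement (X : Euc n → Euc m) (θ : Euc n) : ℝ := √(inducedMetric X θ).det

theorem normDet_fderiv (X : Euc n → Euc m) (θ : Euc n) :
    (fderiv ℝ X θ : Euc n →ₗ[ℝ] Euc m).normDet = areaElement X θ := by
  have h := LinearMap.normDet_sq_eq_det_gram (fderiv ℝ X θ : Euc n →ₗ[ℝ] Euc m)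
    (EuclideanSpace.basisFun (Fin n) ℝ)
  rw [areaElement, ← Real.sqrt_sq (LinearMap.normDet_nonneg _)]
  congr 1
  simp only [RCLike.ofReal_real_eq_id, id_eq] at h
  rw [h]
  congr 1
  ext i j
  simp [inducedMetric, pd, Matrix.gram]

theorem areaElement_pos {X : Euc n → Euc m} {θ : Euc n}
    (h : Function.Injective (fderiv ℝ X θ)) : 0 < areaElement X θ := by
  rw [← normDet_fderiv]
  refine lt_of_le_of_ne (LinearMap.normDet_nonneg _) fun h0 => ?_
  rw [eq_comm, LinearMap.normDet_eq_zero_iff_ker_ne_bot] at h0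
  exact h0 (LinearMap.ker_eq_bot.2 h)

theorem continuousOn_pd {W : Type*} [NormedAddCommGroup W] [NormedSpace ℝ W] {Ω : Set (Euc n)}
    {X : Euc n → W} (hΩ : IsOpen Ω) (hX : ContDiffOn ℝ 1 X Ω) (i : Fin n) :
    ContinuousOn (pd i X) Ω :=
  (hX.continuousOn_fderiv_of_isOpen hΩ le_rfl).clm_apply continuousOn_const

theorem continuousOn_inducedMetric {Ω : Set (Euc n)} {X : Euc n → Euc m} (hΩ : IsOpen Ω)
    (hX : ContDiffOn ℝ 1 X Ω) : ContinuousOn (inducedMetric X) Ω := by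
  refine continuousOn_pi.2 fun i => continuousOn_pi.2 fun j => ?_
  exact (continuousOn_pd hΩ hX i).inner (𝕜 := ℝ) (continuousOn_pd hΩ hX j)

theorem continuousOn_areaElement {Ω : Set (Euc n)} {X : Euc n → Euc m} (hΩ : IsOpen Ω)
    (hX : ContDiffOn ℝ 1 X Ω) : ContinuousOn (areaElement X) Ω :=
  (Continuous.matrix_det continuous_id).comp_continuousOn (continuousOn_inducedMetric hΩ hX)
    |>.sqrt

/-- Near any point, an immersion is bi-Lipschitz to its linearization with constant close to one. -/
theorem exists_nhds_dist_le_linearization {X : Euc n → Euc m} {L : Euc n →L[ℝ] Euc m} {θ : Euc n}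
    (hX : HasStrictFDerivAt X L θ) (hL : Function.Injective L) {K : ℝ≥0} (hK : 1 < K) :
    ∃ U ∈ 𝓝 θ, ∀ a ∈ U, ∀ b ∈ U, dist (X a) (X b) ≤ K * dist (L a) (L b) ∧
      dist (L a) (L b) ≤ K * dist (X a) (X b) := by
  obtain ⟨κ, hκ, hanti⟩ := LinearMap.exists_antilipschitzWith (L : Euc n →ₗ[ℝ] Euc m)
    (LinearMap.ker_eq_bot.2 hL)
  have hK1 : (1 : ℝ) < K := by exact_mod_cast hK
  have hK0 : (0 : ℝ) < K := by linarith
  -- With this choice `1 - ε = 1/K` gives the lower bound exactly, and `1 + ε = 2 - 1/K ≤ K` gives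
  -- the upper one. Approximating to within `ε / κ` turns the error into `ε` times the distance of
  -- the linear images.
  set ε : ℝ≥0 := 1 - K⁻¹ with hε
  have hεr : (ε : ℝ) = 1 - (K : ℝ)⁻¹ := by
    rw [hε, NNReal.coe_sub (inv_le_one_of_one_le₀ hK.le)]; simp
  have hεpos : 0 < ε := by
    rw [← NNReal.coe_pos, hεr]; have := inv_lt_one_of_one_lt₀ hK1; linarith
  obtain ⟨U, hU, happ⟩ := hX.approximates_deriv_on_nhds (c := ε / κ) (Or.inr (by positivity))
  refine ⟨U, hU, fun a ha b hb => ?_⟩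
  have h1 : ‖X a - X b - L (a - b)‖ ≤ ε * dist (L a) (L b) := by
    refine (happ a ha b hb).trans ?_
    have h2 : dist a b ≤ κ * dist (L a) (L b) := hanti.le_mul_dist a b
    rw [← dist_eq_norm, NNReal.coe_div, div_mul_eq_mul_div, mul_div_assoc]
    gcongr
    rw [div_le_iff₀ (by exact_mod_cast hκ)]
    linarith
  rw [map_sub] at h1
  have h3 : dist (X a) (X b) ≤ dist (L a) (L b) + ε * dist (L a) (L b) := by
    rw [dist_eq_norm (X a), dist_eq_norm (L a)] at *
    calc ‖X a - X b‖ = ‖(L a - L b) + (X a - X b - (L a - L b))‖ := by congr 1; abel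
      _ ≤ _ := (norm_add_le _ _).trans (by gcongr)
  have h4 : dist (L a) (L b) ≤ dist (X a) (X b) + ε * dist (L a) (L b) := by
    rw [dist_eq_norm (X a), dist_eq_norm (L a)] at *
    calc ‖L a - L b‖ = ‖(X a - X b) - (X a - X b - (L a - L b))‖ := by congr 1; abel
      _ ≤ _ := (norm_sub_le _ _).trans (by gcongr)
  rw [hεr] at h3 h4
  have hd : 0 ≤ dist (L a) (L b) := dist_nonneg
  have hKi : (K : ℝ) * (K : ℝ)⁻¹ = 1 := mul_inv_cancel₀ hK0.ne'
  constructor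
  · refine h3.trans ?_
    have : 2 - (K : ℝ)⁻¹ ≤ K := by
      have : 0 ≤ (K : ℝ)⁻¹ * (K - 1) ^ 2 := by positivity
      nlinarith
    nlinarith
  · have h5 : (K : ℝ)⁻¹ * dist (L a) (L b) ≤ dist (X a) (X b) := by linarith
    calc dist (L a) (L b) = K * ((K : ℝ)⁻¹ * dist (L a) (L b)) := by
          rw [← mul_assoc, hKi, one_mul]
      _ ≤ _ := by gcongr

/-- Of the `n + 1` factors `K`, `n` come from the Lipschitz comparison with the linearization, and
one from the oscillation of the area element near `θ`. -/
theorem exists_nhds_area_le {Ω : Set (Euc n)} {X : Euc n → Euc m} (hΩ : IsOpen Ω)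
    (hX : ContDiffOn ℝ 1 X Ω) (himm : ∀ θ ∈ Ω, Function.Injective (fderiv ℝ X θ))
    {K : ℝ≥0} (hK : 1 < K) {θ : Euc n} (hθ : θ ∈ Ω) :
    ∃ U ∈ 𝓝 θ, IsOpen U ∧ ∀ E ⊆ U, MeasurableSet E →
      μHE[n] (X '' E) ≤ (K : ℝ≥0∞) ^ (n + 1) * ∫⁻ ϑ in E, ENNReal.ofReal (areaElement X ϑ) ∧
      ∫⁻ ϑ in E, ENNReal.ofReal (areaElement X ϑ) ≤ (K : ℝ≥0∞) ^ (n + 1) * μHE[n] (X '' E) := by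
  have hstrict : HasStrictFDerivAt X (fderiv ℝ X θ) θ :=
    (hX.contDiffAt (hΩ.mem_nhds hθ)).hasStrictFDerivAt one_ne_zero
  obtain ⟨U, hU, hdist⟩ := exists_nhds_dist_le_linearization hstrict (himm θ hθ) hK
  set J := areaElement X θ with hJ
  have hJpos : 0 < J := areaElement_pos (himm θ hθ)
  have hK1 : (1 : ℝ) < K := by exact_mod_cast hK
  have hcont : ContinuousAt (areaElement X) θ :=
    (continuousOn_areaElement hΩ hX).continuousAt (hΩ.mem_nhds hθ)
  have hc1 : ∀ᶠ ϑ in 𝓝 θ, areaElement X ϑ < K * J :=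
    hcont.eventually_lt continuousAt_const (by rw [← hJ]; nlinarith)
  have hc2 : ∀ᶠ ϑ in 𝓝 θ, J < K * areaElement X ϑ :=
    continuousAt_const.eventually_lt (continuousAt_const.mul hcont) (by rw [← hJ]; nlinarith)
  obtain ⟨V, hV, hVo, hVθ⟩ := mem_nhds_iff.1 (inter_mem hU (inter_mem hc1 hc2))
  have hlin : ∀ E : Set (Euc n), μHE[n] (fderiv ℝ X θ '' E) = ENNReal.ofReal J * volume E := by
    intro E
    have := (fderiv ℝ X θ : Euc n →ₗ[ℝ] Euc m).euclideanHausdorffMeasure_image_eq_normDet_mul_volume E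
    rw [normDet_fderiv] at this
    simpa using this
  refine ⟨V, hVo.mem_nhds hVθ, hVo, fun E hE hEm => ⟨?_, ?_⟩⟩
  · calc μHE[n] (X '' E) ≤ (K : ℝ≥0∞) ^ n * μHE[n] (fderiv ℝ X θ '' E) :=
          euclideanHausdorffMeasure_image_le_of_dist_le n K fun a ha b hb =>
            (hdist a (hV (hE ha)).1 b (hV (hE hb)).1).1
      _ = (K : ℝ≥0∞) ^ n * ∫⁻ _ in E, ENNReal.ofReal J := by
          rw [hlin, setLIntegral_const]
      _ ≤ (K : ℝ≥0∞) ^ n * ∫⁻ ϑ in E, K * ENNReal.ofReal (areaElement X ϑ) := by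
          gcongr 1
          refine setLIntegral_mono' hEm fun ϑ hϑ => ?_
          rw [← ENNReal.ofReal_coe_nnreal, ← ENNReal.ofReal_mul (by positivity)]
          exact ENNReal.ofReal_le_ofReal (hV (hE hϑ)).2.2.le
      _ = _ := by
          rw [lintegral_const_mul' _ _ ENNReal.coe_ne_top, pow_succ, mul_assoc]
  · calc ∫⁻ ϑ in E, ENNReal.ofReal (areaElement X ϑ) ≤ ∫⁻ _ in E, K * ENNReal.ofReal J := by
          refine setLIntegral_mono' hEm fun ϑ hϑ => ?_
          rw [← ENNReal.ofReal_coe_nnreal, ← ENNReal.ofReal_mul (by positivity)]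
          exact ENNReal.ofReal_le_ofReal (hV (hE hϑ)).2.1.le
      _ = K * μHE[n] (fderiv ℝ X θ '' E) := by
          rw [hlin, setLIntegral_const, mul_assoc]
      _ ≤ K * ((K : ℝ≥0∞) ^ n * μHE[n] (X '' E)) := by
          gcongr 1
          exact euclideanHausdorffMeasure_image_le_of_dist_le n K fun a ha b hb =>
            (hdist a (hV (hE ha)).1 b (hV (hE hb)).1).2
      _ = _ := by rw [pow_succ', mul_assoc]

/-- Let `K` decrease to `1`. Multiplication by `b` is continuous at the limit even for `b = ∞`,
since the limit of `K ^ d` is not zero. -/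
theorem le_of_forall_one_lt_pow_mul {a b : ℝ≥0∞} (d : ℕ)
    (h : ∀ K : ℝ≥0, 1 < K → a ≤ (K : ℝ≥0∞) ^ d * b) : a ≤ b := by
  have hlim : Tendsto (fun K : ℝ≥0 => (K : ℝ≥0∞) ^ d * b) (𝓝[>] 1) (𝓝 ((1 : ℝ≥0∞) ^ d * b)) := by
    refine ENNReal.Tendsto.mul_const ?_ (Or.inl (by simp))
    refine Tendsto.mono_left ?_ nhdsWithin_le_nhds
    have : Continuous fun K : ℝ≥0 => (K : ℝ≥0∞) ^ d := by fun_prop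
    simpa using this.tendsto 1
  rw [one_pow, one_mul] at hlim
  exact ge_of_tendsto hlim (by filter_upwards [self_mem_nhdsWithin] with K hK using h K hK)

/-- **Area formula** for injective immersions of class `C¹`. -/
theorem euclideanHausdorffMeasure_image_eq {Ω : Set (Euc n)} {X : Euc n → Euc m} (hΩ : IsOpen Ω)
    (hX : ContDiffOn ℝ 1 X Ω) (himm : ∀ θ ∈ Ω, Function.Injective (fderiv ℝ X θ))
    (hinj : InjOn X Ω) {E : Set (Euc n)} (hE : E ⊆ Ω) (hEm : MeasurableSet E) :
    μHE[n] (X '' E) = ∫⁻ ϑ in E, ENNReal.ofReal (areaElement X ϑ) := by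
  have key : ∀ K : ℝ≥0, 1 < K →
      μHE[n] (X '' E) ≤ (K : ℝ≥0∞) ^ (n + 1) * ∫⁻ ϑ in E, ENNReal.ofReal (areaElement X ϑ) ∧
      ∫⁻ ϑ in E, ENNReal.ofReal (areaElement X ϑ) ≤ (K : ℝ≥0∞) ^ (n + 1) * μHE[n] (X '' E) := by
    intro K hK
    choose! U hU hUo hUE using fun θ (hθ : θ ∈ Ω) => exists_nhds_area_le hΩ hX himm hK hθ
    obtain ⟨s, hsΩ, hsc, hcov⟩ := TopologicalSpace.countable_cover_nhdsWithin
      (s := Ω) (f := U) fun θ hθ => mem_nhdsWithin_of_mem_nhds (hU θ hθ)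
    have := hsc.to_subtype
    rcases s.eq_empty_or_nonempty with rfl | hsne
    · have : E = ∅ := by
        rw [← subset_empty_iff]; refine hE.trans (hcov.trans ?_); simp
      simp [this]
    obtain ⟨e, he⟩ := hsc.exists_eq_range hsne
    -- Disjoint measurable pieces of `E`, each inside a neighbourhood where the local estimate holds
    -- with the same `K`. Injectivity keeps the images disjoint, so both sides are countably
    -- additive along the pieces.
    set V : ℕ → Set (Euc n) := fun i => E ∩ disjointed (fun i => U (e i)) i with hV
    have heΩ : ∀ i, e i ∈ Ω := fun i => hsΩ (he ▸ mem_range_self i)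
    have hVm : ∀ i, MeasurableSet (V i) := fun i =>
      hEm.inter (MeasurableSet.disjointed (fun i => (hUo _ (heΩ i)).measurableSet) i)
    have hVdisj : Pairwise (Disjoint on V) := fun i j hij =>
      (disjoint_disjointed (fun i => U (e i)) hij).mono inter_subset_right inter_subset_right
    have hVU : ∀ i, V i ⊆ U (e i) := fun i =>
      inter_subset_right.trans (disjointed_le _ i)
    have hEV : E = ⋃ i, V i := by
      rw [hV, ← inter_iUnion, iUnion_disjointed, eq_comm, inter_eq_left]
      refine hE.trans (hcov.trans ?_)
      rw [he, biUnion_range]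
    have hVΩ : ∀ i, V i ⊆ Ω := fun i => inter_subset_left.trans hE
    have hXm : ∀ i, MeasurableSet (X '' V i) := fun i =>
      (hVm i).image_of_continuousOn_injOn (hX.continuousOn.mono (hVΩ i)) (hinj.mono (hVΩ i))
    have hXdisj : Pairwise (Disjoint on fun i => X '' V i) := fun i j hij => by
      have := hVdisj hij
      rw [Function.onFun, disjoint_iff_inter_eq_empty] at this ⊢
      rw [← hinj.image_inter (hVΩ i) (hVΩ j), this, image_empty]
    have h1 : μHE[n] (X '' E) = ∑' i, μHE[n] (X '' V i) := by
      conv_lhs => rw [hEV]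
      rw [image_iUnion, measure_iUnion hXdisj hXm]
    have h2 : ∫⁻ ϑ in E, ENNReal.ofReal (areaElement X ϑ) =
        ∑' i, ∫⁻ ϑ in V i, ENNReal.ofReal (areaElement X ϑ) := by
      conv_lhs => rw [hEV]
      rw [lintegral_iUnion hVm hVdisj]
    rw [h1, h2, ← ENNReal.tsum_mul_left, ← ENNReal.tsum_mul_left]
    exact ⟨ENNReal.tsum_le_tsum fun i => (hUE _ (heΩ i) _ (hVU i) (hVm i)).1,
      ENNReal.tsum_le_tsum fun i => (hUE _ (heΩ i) _ (hVU i) (hVm i)).2⟩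
  exact le_antisymm (le_of_forall_one_lt_pow_mul _ fun K hK => (key K hK).1)
    (le_of_forall_one_lt_pow_mul _ fun K hK => (key K hK).2)

theorem aemeasurable_withDensity_restrict {Ω : Set (Euc n)} {X : Euc n → Euc m} (hΩ : IsOpen Ω)
    (hX : ContinuousOn X Ω) (w : Euc n → ℝ≥0∞) :
    AEMeasurable X ((volume.restrict Ω).withDensity w) :=
  (hX.aemeasurable hΩ.measurableSet).mono_ac (withDensity_absolutelyContinuous _ _)

/-- The surface measure on the image of a parametrization is the image of the area element. -/
theorem map_withDensity_areaElement {Ω : Set (Euc n)} {X : Euc n → Euc m} (hΩ : IsOpen Ω)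
    (hX : ContDiffOn ℝ 1 X Ω) (himm : ∀ θ ∈ Ω, Function.Injective (fderiv ℝ X θ))
    (hinj : InjOn X Ω) :
    Measure.map X ((volume.restrict Ω).withDensity fun ϑ => ENNReal.ofReal (areaElement X ϑ)) =
      (μHE[n] : Measure (Euc m)).restrict (X '' Ω) := by
  ext S hS
  -- Off `Ω` nothing is known about `X`, so only the part of the preimage inside `Ω` is measurable.
  have hpre : MeasurableSet (X ⁻¹' S ∩ Ω) := by
    have hm : Measurable (Ω.domRestrict X) := hX.continuousOn.domRestrict.measurable
    have := (MeasurableEmbedding.subtype_coe hΩ.measurableSet).measurableSet_image.2 (hm hS)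
    convert this using 1
    ext θ
    simp [Set.domRestrict, and_comm]
  rw [Measure.map_apply_of_aemeasurable
    (aemeasurable_withDensity_restrict hΩ hX.continuousOn _) hS, Measure.restrict_apply hS,
    withDensity_apply' _ (X ⁻¹' S)]
  rw [Measure.restrict_restrict' hΩ.measurableSet,
    ← euclideanHausdorffMeasure_image_eq hΩ hX himm hinj inter_subset_right hpre,
    inter_comm _ Ω, image_inter_preimage, inter_comm]

end AreaFormula

/-! ### The Laplacian as a divergence and integration by parts in coordinates -/

section Divergence

variable {n m : ℕ}

theorem pd_mul {f g : Euc n → ℝ} {θ : Euc n} (hf : DifferentiableAt ℝ f θ)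
    (hg : DifferentiableAt ℝ g θ) (i : Fin n) :
    pd i (fun ϑ => f ϑ * g ϑ) θ = pd i f θ * g θ + f θ * pd i g θ := by
  simp only [pd]
  rw [fderiv_fun_mul hf hg]
  simp only [add_apply, smul_apply, smul_eq_mul]
  ring

theorem pd_sum {W : Type*} [NormedAddCommGroup W] [NormedSpace ℝ W] {ι : Type*} (s : Finset ι)
    {f : ι → Euc n → W} {θ : Euc n}
    (hf : ∀ a ∈ s, DifferentiableAt ℝ (f a) θ) (i : Fin n) :
    pd i (fun ϑ => ∑ a ∈ s, f a ϑ) θ = ∑ a ∈ s, pd i (f a) θ := by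
  simp only [pd]
  rw [fderiv_fun_sum hf]
  simp

theorem pd_inner {f g : Euc n → Euc m} {θ : Euc n} (hf : DifferentiableAt ℝ f θ)
    (hg : DifferentiableAt ℝ g θ) (i : Fin n) :
    pd i (fun ϑ => ⟪f ϑ, g ϑ⟫) θ = ⟪pd i f θ, g θ⟫ + ⟪f θ, pd i g θ⟫ := by
  simp only [pd]
  rw [fderiv_inner_apply ℝ hf hg, add_comm]

theorem contDiffOn_det {Ω : Set (Euc n)} {k : ℕ} {g : Euc n → Matrix (Fin k) (Fin k) ℝ}
    (hg : ∀ i j, ContDiffOn ℝ 1 (fun θ => g θ i j) Ω) :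
    ContDiffOn ℝ 1 (fun θ => (g θ).det) Ω := by
  simp only [Matrix.det_apply']
  exact ContDiffOn.sum fun σ _ => contDiffOn_const.mul (contDiffOn_prod fun i _ => hg _ _)

theorem contDiffOn_inv_matrix {Ω : Set (Euc n)} {k : ℕ} {g : Euc n → Matrix (Fin k) (Fin k) ℝ}
    (hg : ∀ i j, ContDiffOn ℝ 1 (fun θ => g θ i j) Ω) (hdet : ∀ θ ∈ Ω, (g θ).det ≠ 0)
    (i j : Fin k) : ContDiffOn ℝ 1 (fun θ => (g θ)⁻¹ i j) Ω := by
  simp only [Matrix.inv_def, Ring.inverse_eq_inv', Matrix.smul_apply, smul_eq_mul,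
    Matrix.adjugate_apply]
  refine ((contDiffOn_det hg).inv hdet).mul (contDiffOn_det fun a b => ?_)
  simp only [Matrix.updateRow_apply]
  split_ifs
  · exact contDiffOn_const
  · exact hg _ _

/-- **Jacobi's formula** for the derivative of a determinant. -/
theorem pd_det {k : ℕ} {g : Euc n → Matrix (Fin k) (Fin k) ℝ} {θ : Euc n}
    (hg : ∀ i j, DifferentiableAt ℝ (fun θ => g θ i j) θ) (hdet : (g θ).det ≠ 0) (c : Fin n) :
    pd c (fun ϑ => (g ϑ).det) θ =
      (g θ).det * ∑ i, ∑ j, (g θ)⁻¹ i j * pd c (fun ϑ => g ϑ j i) θ := by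
  -- Differentiating the Leibniz expansion replaces one column at a time by its derivative; Cramer's
  -- rule then evaluates each such determinant through the adjugate.
  have h1 : pd c (fun ϑ => (g ϑ).det) θ =
      ∑ i, ((g θ).updateCol i fun j => pd c (fun ϑ => g ϑ j i) θ).det := by
    have hprod : ∀ σ : Equiv.Perm (Fin k), HasFDerivAt (fun ϑ => ∏ i, g ϑ (σ i) i) _ θ :=
      fun σ => HasFDerivAt.finsetProd (u := Finset.univ) (x := θ)
        (fun i (_ : i ∈ Finset.univ) => (hg (σ i) i).hasFDerivAt)
    simp only [Matrix.det_apply']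
    rw [pd_sum _ (fun σ _ => (hprod σ).differentiableAt.const_mul _),
      Finset.sum_comm]
    refine Finset.sum_congr rfl fun σ _ => ?_
    rw [← Finset.mul_sum]
    rw [pd_mul (by fun_prop) (hprod σ).differentiableAt]
    simp only [pd]
    rw [(hprod σ).fderiv]
    simp only [fderiv_fun_const, Pi.zero_apply, zero_apply, zero_mul, zero_add,
      sum_apply, smul_apply, smul_eq_mul]
    congr 1
    refine Finset.sum_congr rfl fun i _ => ?_
    rw [← Finset.mul_prod_erase Finset.univ _ (Finset.mem_univ i), mul_comm]
    congr 1
    · simp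
    · refine Finset.prod_congr rfl fun j hj => ?_
      rw [Matrix.updateCol_ne (Finset.ne_of_mem_erase hj)]
  have hadj : (g θ).adjugate = (g θ).det • (g θ)⁻¹ := by
    rw [Matrix.inv_def, smul_smul, Ring.inverse_eq_inv', mul_inv_cancel₀ hdet, one_smul]
  rw [h1, Finset.mul_sum]
  refine Finset.sum_congr rfl fun i _ => ?_
  rw [← Matrix.cramer_apply, Matrix.cramer_eq_adjugate_mulVec, hadj, Finset.mul_sum]
  simp only [Matrix.mulVec, dotProduct, Matrix.smul_apply, smul_eq_mul, mul_assoc]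

/-- Differentiate `g⁻¹ g = 1`, which holds near `θ`, and multiply by `g⁻¹` on the right. -/
theorem pd_inv_matrix {k : ℕ} {Ω : Set (Euc n)} (hΩ : IsOpen Ω)
    {g : Euc n → Matrix (Fin k) (Fin k) ℝ}
    (hg : ∀ i j, ContDiffOn ℝ 1 (fun θ => g θ i j) Ω) (hdet : ∀ θ ∈ Ω, (g θ).det ≠ 0)
    {θ : Euc n} (hθ : θ ∈ Ω) (c : Fin n) (i j : Fin k) :
    pd c (fun ϑ => (g ϑ)⁻¹ i j) θ =
      - ∑ a, ∑ b, (g θ)⁻¹ i a * pd c (fun ϑ => g ϑ a b) θ * (g θ)⁻¹ b j := by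
  have hgd : ∀ i j, DifferentiableAt ℝ (fun θ => g θ i j) θ := fun i j =>
    ((hg i j).contDiffAt (hΩ.mem_nhds hθ)).differentiableAt one_ne_zero
  have hid : ∀ i j, DifferentiableAt ℝ (fun θ => (g θ)⁻¹ i j) θ := fun i j =>
    ((contDiffOn_inv_matrix hg hdet i j).contDiffAt (hΩ.mem_nhds hθ)).differentiableAt one_ne_zero
  set D : Matrix (Fin k) (Fin k) ℝ := Matrix.of fun a b => pd c (fun ϑ => g ϑ a b) θ with hD
  set I : Matrix (Fin k) (Fin k) ℝ := Matrix.of fun a b => pd c (fun ϑ => (g ϑ)⁻¹ a b) θ with hI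
  have hu : ∀ ϑ ∈ Ω, IsUnit (g ϑ).det := fun ϑ hϑ => isUnit_iff_ne_zero.2 (hdet ϑ hϑ)
  have h1 : I * g θ + (g θ)⁻¹ * D = 0 := by
    ext a b
    have h2 : (fun ϑ => ∑ q, (g ϑ)⁻¹ a q * g ϑ q b) =ᶠ[𝓝 θ]
        fun _ => (1 : Matrix (Fin k) (Fin k) ℝ) a b := by
      filter_upwards [hΩ.mem_nhds hθ] with ϑ hϑ
      rw [← Matrix.nonsing_inv_mul _ (hu ϑ hϑ), Matrix.mul_apply]
    have h3 : pd c (fun ϑ => ∑ q, (g ϑ)⁻¹ a q * g ϑ q b) θ = 0 := by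
      rw [pd, h2.fderiv_eq]; simp
    rw [pd_sum _ fun q _ => (hid a q).fun_mul (hgd q b)] at h3
    simp only [pd_mul (hid _ _) (hgd _ _), Finset.sum_add_distrib] at h3
    simpa [Matrix.mul_apply, hI, hD] using h3
  have h2 : I = - ((g θ)⁻¹ * D * (g θ)⁻¹) := by
    have h3 : I * g θ * (g θ)⁻¹ = - ((g θ)⁻¹ * D) * (g θ)⁻¹ := by
      rw [eq_neg_of_add_eq_zero_left h1]
    rwa [Matrix.mul_assoc, Matrix.mul_nonsing_inv _ (hu θ hθ), Matrix.mul_one,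
      Matrix.neg_mul] at h3
  have h3 := congrFun (congrFun h2 i) j
  rw [hI, hD] at h3
  simp only [Matrix.of_apply, Matrix.neg_apply, Matrix.mul_apply, Finset.sum_mul] at h3
  rw [h3, Finset.sum_comm]

/-- The contraction `gⁱʲ Γᵏᵢⱼ` of the Christoffel symbols; `G` stands for the inverse metric and
`D l i j` for the derivative `∂ₗ gᵢⱼ`. -/
theorem christoffel_contraction (G : Fin n → Fin n → ℝ) (D : Fin n → Fin n → Fin n → ℝ)
    (hG : ∀ i j, G i j = G j i) (k : Fin n) :
    ∑ i, ∑ j, G i j * (1 / 2 * ∑ l, G k l * (D i l j + D j l i - D l i j)) =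
      ∑ j, (∑ a, ∑ b, G k a * D j a b * G b j) -
        ∑ l, (1 / 2 * ∑ i, ∑ j, G i j * D l i j) * G k l := by
  -- By symmetry of `G` the first two derivative terms of the Christoffel symbol contribute equally
  -- (`e1`, `e2`), which absorbs the factor `1/2`; only the third keeps it.
  have e1 : ∑ i, ∑ j, ∑ l, G i j * G k l * D i l j = ∑ j, ∑ a, ∑ b, G k a * D j a b * G b j := by
    refine Finset.sum_congr rfl fun i _ => ?_
    rw [Finset.sum_comm]
    refine Finset.sum_congr rfl fun l _ => Finset.sum_congr rfl fun j _ => ?_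
    rw [hG i j]; ring
  have e2 : ∑ i, ∑ j, ∑ l, G i j * G k l * D j l i = ∑ i, ∑ j, ∑ l, G i j * G k l * D i l j := by
    rw [Finset.sum_comm]
    refine Finset.sum_congr rfl fun i _ => Finset.sum_congr rfl fun j _ =>
      Finset.sum_congr rfl fun l _ => ?_
    rw [hG i j]
  have e3 : ∑ i, ∑ j, ∑ l, G i j * G k l * D l i j =
      ∑ l, (∑ i, ∑ j, G i j * D l i j) * G k l := by
    simp only [Finset.sum_mul]
    rw [Finset.sum_congr rfl fun i _ => Finset.sum_comm, Finset.sum_comm]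
    refine Finset.sum_congr rfl fun i _ => Finset.sum_congr rfl fun j _ =>
      Finset.sum_congr rfl fun l _ => ?_
    ring
  have e4 : ∑ i, ∑ j, G i j * (1 / 2 * ∑ l, G k l * (D i l j + D j l i - D l i j)) =
      1 / 2 * (∑ i, ∑ j, ∑ l, G i j * G k l * D i l j + ∑ i, ∑ j, ∑ l, G i j * G k l * D j l i -
        ∑ i, ∑ j, ∑ l, G i j * G k l * D l i j) := by
    simp only [← Finset.sum_add_distrib, ← Finset.sum_sub_distrib, Finset.mul_sum]
    refine Finset.sum_congr rfl fun i _ => Finset.sum_congr rfl fun j _ =>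
      Finset.sum_congr rfl fun l _ => ?_
    ring
  rw [e4, e2, e1, e3]
  simp only [mul_assoc (1 / 2 : ℝ), ← Finset.mul_sum]
  ring

theorem contDiffOn_pd {W : Type*} [NormedAddCommGroup W] [NormedSpace ℝ W] {Ω : Set (Euc n)}
    {Y : Euc n → W} (hΩ : IsOpen Ω) (hY : ContDiffOn ℝ 2 Y Ω) (i : Fin n) :
    ContDiffOn ℝ 1 (pd i Y) Ω :=
  (hY.fderiv_of_isOpen hΩ (by norm_num)).clm_apply contDiffOn_const

/-- The components `√det g gⁱʲ ∂ᵢY · ψ` of the flux of `Y` tested with `ψ`. -/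
noncomputable def flux (g : Euc n → Matrix (Fin n) (Fin n) ℝ) (Y ψ : Euc n → Euc m) (j : Fin n)
    (θ : Euc n) : ℝ :=
  √(g θ).det * ∑ i, (g θ)⁻¹ i j * ⟪pd i Y θ, ψ θ⟫

theorem contDiffOn_flux {Ω : Set (Euc n)} (hΩ : IsOpen Ω)
    {g : Euc n → Matrix (Fin n) (Fin n) ℝ}
    (hg : ∀ i j, ContDiffOn ℝ 1 (fun θ => g θ i j) Ω) (hdet : ∀ θ ∈ Ω, 0 < (g θ).det)
    {Y ψ : Euc n → Euc m} (hY : ContDiffOn ℝ 2 Y Ω) (hψ : ContDiffOn ℝ 1 ψ Ω) (j : Fin n) :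
    ContDiffOn ℝ 1 (flux g Y ψ j) Ω :=
  ((contDiffOn_det hg).sqrt fun θ hθ => (hdet θ hθ).ne').mul <| ContDiffOn.sum fun i _ =>
    (contDiffOn_inv_matrix hg (fun θ hθ => (hdet θ hθ).ne') i j).mul
      ((contDiffOn_pd hΩ hY i).inner ℝ hψ)

/-- The Laplacian in divergence form. -/
theorem sum_pd_flux {Ω : Set (Euc n)} (hΩ : IsOpen Ω)
    {g : Euc n → Matrix (Fin n) (Fin n) ℝ} (hsymm : ∀ θ, (g θ)ᵀ = g θ)
    (hg : ∀ i j, ContDiffOn ℝ 1 (fun θ => g θ i j) Ω) (hdet : ∀ θ ∈ Ω, 0 < (g θ).det)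
    {Y ψ : Euc n → Euc m} (hY : ContDiffOn ℝ 2 Y Ω) (hψ : ContDiffOn ℝ 1 ψ Ω)
    {θ : Euc n} (hθ : θ ∈ Ω) :
    ∑ j, pd j (flux g Y ψ j) θ = √(g θ).det *
      (∑ i, ∑ j, (g θ)⁻¹ i j * ⟪pd i Y θ, pd j ψ θ⟫ + ⟪laplacian g Y θ, ψ θ⟫) := by
  have hdet' : ∀ θ ∈ Ω, (g θ).det ≠ 0 := fun θ hθ => (hdet θ hθ).ne'
  have hnhds := hΩ.mem_nhds hθ
  have hgd : ∀ i j, DifferentiableAt ℝ (fun θ => g θ i j) θ := fun i j =>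
    ((hg i j).contDiffAt hnhds).differentiableAt one_ne_zero
  have hid : ∀ i j, DifferentiableAt ℝ (fun θ => (g θ)⁻¹ i j) θ := fun i j =>
    ((contDiffOn_inv_matrix hg hdet' i j).contDiffAt hnhds).differentiableAt one_ne_zero
  have hdd : DifferentiableAt ℝ (fun θ => (g θ).det) θ :=
    ((contDiffOn_det hg).contDiffAt hnhds).differentiableAt one_ne_zero
  have hsd : DifferentiableAt ℝ (fun θ => √(g θ).det) θ := hdd.sqrt (hdet' θ hθ)
  have hψd : DifferentiableAt ℝ ψ θ := (hψ.contDiffAt hnhds).differentiableAt one_ne_zero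
  have hYd : ∀ i, DifferentiableAt ℝ (pd i Y) θ := fun i =>
    ((contDiffOn_pd hΩ hY i).contDiffAt hnhds).differentiableAt one_ne_zero
  have hsym : ∀ ϑ i j, g ϑ i j = g ϑ j i := fun ϑ i j => congrFun (congrFun (hsymm ϑ) j) i
  have hGsym : ∀ i j, (g θ)⁻¹ i j = (g θ)⁻¹ j i := fun i j => by
    have := Matrix.transpose_nonsing_inv (g θ)
    rw [hsymm] at this
    exact congrFun (congrFun this j) i
  set s := √(g θ).det with hs
  have hs0 : s ≠ 0 := (Real.sqrt_pos.2 (hdet θ hθ)).ne'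
  -- Logarithmic derivative of `√det g`, from Jacobi's formula.
  have hpds : ∀ j, pd j (fun ϑ => √(g ϑ).det) θ =
      s * (1 / 2 * ∑ a, ∑ b, (g θ)⁻¹ a b * pd j (fun ϑ => g ϑ a b) θ) := by
    intro j
    have h1 : pd j (fun ϑ => √(g ϑ).det) θ = 1 / (2 * s) * pd j (fun ϑ => (g ϑ).det) θ := by
      simp only [pd]
      rw [fderiv_sqrt hdd (hdet' θ hθ)]
      simp [hs]
    rw [h1, pd_det hgd (hdet' θ hθ)]
    have h2 : (g θ).det = s * s := (Real.mul_self_sqrt (hdet θ hθ).le).symm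
    have h3 : ∀ a b, pd j (fun ϑ => g ϑ b a) θ = pd j (fun ϑ => g ϑ a b) θ := fun a b => by
      congr 1; ext ϑ; exact hsym ϑ b a
    simp only [h3]
    rw [h2]
    field_simp
  have hflux : ∀ j, pd j (flux g Y ψ j) θ =
      s * ∑ i, ((1 / 2 * ∑ a, ∑ b, (g θ)⁻¹ a b * pd j (fun ϑ => g ϑ a b) θ) *
          (g θ)⁻¹ i j * ⟪pd i Y θ, ψ θ⟫
        - (∑ a, ∑ b, (g θ)⁻¹ i a * pd j (fun ϑ => g ϑ a b) θ * (g θ)⁻¹ b j) * ⟪pd i Y θ, ψ θ⟫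
        + (g θ)⁻¹ i j * (⟪pd j (pd i Y) θ, ψ θ⟫ + ⟪pd i Y θ, pd j ψ θ⟫)) := by
    intro j
    have hterm : ∀ i, DifferentiableAt ℝ (fun ϑ => (g ϑ)⁻¹ i j * ⟪pd i Y ϑ, ψ ϑ⟫) θ := fun i =>
      (hid i j).fun_mul ((hYd i).inner ℝ hψd)
    unfold flux
    rw [pd_mul hsd (DifferentiableAt.fun_sum fun i _ => hterm i), pd_sum _ fun i _ => hterm i,
      hpds, mul_assoc s, ← hs, ← mul_add, Finset.mul_sum, ← Finset.sum_add_distrib]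
    congr 1
    refine Finset.sum_congr rfl fun i _ => ?_
    rw [pd_mul (hid i j) ((hYd i).inner ℝ hψd), pd_inner (hYd i) hψd,
      pd_inv_matrix hΩ hg hdet' hθ]
    ring
  have hlap : ⟪laplacian g Y θ, ψ θ⟫ =
      ∑ i, ∑ j, (g θ)⁻¹ i j * ⟪pd i (pd j Y) θ, ψ θ⟫ -
        ∑ k, (∑ i, ∑ j, (g θ)⁻¹ i j * christoffel g k i j θ) * ⟪pd k Y θ, ψ θ⟫ := by
    simp only [laplacian, sum_inner, inner_sub_left, real_inner_smul_left, mul_sub,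
      Finset.sum_sub_distrib, Finset.mul_sum, Finset.sum_mul]
    congr 1
    rw [Finset.sum_congr rfl fun i _ => Finset.sum_comm, Finset.sum_comm]
    refine Finset.sum_congr rfl fun k _ => Finset.sum_congr rfl fun i _ =>
      Finset.sum_congr rfl fun j _ => ?_
    ring
  -- The contracted Christoffel symbols are exactly what the product rule yields from
  -- differentiating `g⁻¹` and `√det g`, up to sign, so these terms cancel.
  have hchr : ∀ k, ∑ i, ∑ j, (g θ)⁻¹ i j * christoffel g k i j θ = _ := fun k =>
    christoffel_contraction (fun i j => (g θ)⁻¹ i j) (fun l i j => pd l (fun ϑ => g ϑ i j) θ)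
      hGsym k
  rw [hlap]
  simp only [hchr, hflux, ← Finset.mul_sum]
  congr 1
  simp only [Finset.sum_add_distrib, Finset.sum_sub_distrib, mul_add]
  -- Renaming indices and the symmetry of `g⁻¹` suffice; second derivatives need not be commuted.
  have t1 : ∑ j, ∑ i, (g θ)⁻¹ i j * ⟪pd j (pd i Y) θ, ψ θ⟫ =
      ∑ i, ∑ j, (g θ)⁻¹ i j * ⟪pd i (pd j Y) θ, ψ θ⟫ := by
    refine Finset.sum_congr rfl fun i _ => Finset.sum_congr rfl fun j _ => ?_
    rw [hGsym]
  have t2 : ∑ j, ∑ i, (g θ)⁻¹ i j * ⟪pd i Y θ, pd j ψ θ⟫ =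
      ∑ i, ∑ j, (g θ)⁻¹ i j * ⟪pd i Y θ, pd j ψ θ⟫ := Finset.sum_comm
  rw [t1, t2]
  simp only [sub_mul, Finset.sum_sub_distrib]
  have t3 : ∑ j, ∑ i, (1 / 2 * ∑ a, ∑ b, (g θ)⁻¹ a b * pd j (fun ϑ => g ϑ a b) θ) *
      (g θ)⁻¹ i j * ⟪pd i Y θ, ψ θ⟫ = ∑ k, (∑ l, (1 / 2 * ∑ i, ∑ j, (g θ)⁻¹ i j *
        pd l (fun ϑ => g ϑ i j) θ) * (g θ)⁻¹ k l) * ⟪pd k Y θ, ψ θ⟫ := by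
    rw [Finset.sum_comm]
    exact Finset.sum_congr rfl fun i _ => (Finset.sum_mul _ _ _).symm
  have t4 : ∑ j, ∑ i, (∑ a, ∑ b, (g θ)⁻¹ i a * pd j (fun ϑ => g ϑ a b) θ * (g θ)⁻¹ b j) *
      ⟪pd i Y θ, ψ θ⟫ = ∑ k, (∑ j, ∑ a, ∑ b, (g θ)⁻¹ k a * pd j (fun ϑ => g ϑ a b) θ *
        (g θ)⁻¹ b j) * ⟪pd k Y θ, ψ θ⟫ := by
    rw [Finset.sum_comm]
    exact Finset.sum_congr rfl fun i _ => (Finset.sum_mul _ _ _).symm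
  rw [t3, t4]
  ring

/-- Integration by parts against the constant function `1`. -/
theorem integral_pd_eq_zero {f : Euc n → ℝ} (hf : ContDiff ℝ 1 f) (hc : HasCompactSupport f)
    (j : Fin n) : ∫ θ, pd j f θ = 0 := by
  have hcont : Continuous (pd j f) :=
    (hf.continuous_fderiv one_ne_zero).clm_apply continuous_const
  have hint : Integrable (pd j f) := hcont.integrable_of_hasCompactSupport (hc.fderiv_apply ℝ _)
  have := integral_mul_fderiv_eq_neg_fderiv_mul_of_integrable (μ := volume) (f := fun _ => (1 : ℝ))
    (g := f) (v := EuclideanSpace.single j 1) (by simp) (by simp only [one_mul]; exact hint)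
    (by simpa using hf.continuous.integrable_of_hasCompactSupport hc) (by fun_prop)
    (fun x _ => hf.differentiable one_ne_zero x)
  simpa [pd] using this

/-- Integration by parts for the Laplacian in a coordinate domain. -/
theorem integral_laplacian_by_parts {Ω : Set (Euc n)} (hΩ : IsOpen Ω)
    {g : Euc n → Matrix (Fin n) (Fin n) ℝ} (hsymm : ∀ θ, (g θ)ᵀ = g θ)
    (hg : ∀ i j, ContDiffOn ℝ 1 (fun θ => g θ i j) Ω) (hdet : ∀ θ ∈ Ω, 0 < (g θ).det)
    {Y ψ : Euc n → Euc m} (hY : ContDiffOn ℝ 2 Y Ω) (hψ : ContDiffOn ℝ 1 ψ Ω)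
    {K : Set (Euc n)} (hK : IsCompact K) (hKΩ : K ⊆ Ω) (hψK : ∀ θ ∈ Ω, θ ∉ K → ψ θ = 0) :
    ∫ θ in Ω, √(g θ).det *
      (∑ i, ∑ j, (g θ)⁻¹ i j * ⟪pd i Y θ, pd j ψ θ⟫ + ⟪laplacian g Y θ, ψ θ⟫) = 0 := by
  -- Extended by zero, the flux is `C¹` on the whole space: near points of `K` it is the flux
  -- itself, and off the closed set `K` it vanishes locally.
  set F : Fin n → Euc n → ℝ := fun j => Ω.indicator (flux g Y ψ j) with hF
  have hFzero : ∀ j, ∀ θ ∉ K, F j θ = 0 := fun j θ hθ => by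
    by_cases h : θ ∈ Ω
    · simp [hF, h, flux, hψK θ h hθ]
    · simp [hF, h]
  have hFev : ∀ j, ∀ θ ∈ Ω, F j =ᶠ[𝓝 θ] flux g Y ψ j := fun j θ hθ => by
    filter_upwards [hΩ.mem_nhds hθ] with ϑ hϑ using indicator_of_mem hϑ _
  have hFev0 : ∀ j, ∀ θ ∉ K, F j =ᶠ[𝓝 θ] fun _ => 0 := fun j θ hθ => by
    filter_upwards [hK.isClosed.isOpen_compl.mem_nhds hθ] with ϑ hϑ using hFzero j ϑ hϑ
  have hFc : ∀ j, ContDiff ℝ 1 (F j) := fun j => by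
    refine contDiff_iff_contDiffAt.2 fun θ => ?_
    by_cases h : θ ∈ K
    · exact ((contDiffOn_flux hΩ hg hdet hY hψ j).contDiffAt
        (hΩ.mem_nhds (hKΩ h))).congr_of_eventuallyEq (hFev j θ (hKΩ h))
    · exact contDiffAt_const.congr_of_eventuallyEq (hFev0 j θ h)
  have hFs : ∀ j, HasCompactSupport (F j) := fun j =>
    HasCompactSupport.intro hK (hFzero j)
  calc _ = ∫ θ in Ω, ∑ j, pd j (F j) θ := by
        refine setIntegral_congr_fun hΩ.measurableSet fun θ hθ => ?_
        rw [← sum_pd_flux hΩ hsymm hg hdet hY hψ hθ]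
        refine Finset.sum_congr rfl fun j _ => ?_
        rw [pd, pd, (hFev j θ hθ).fderiv_eq]
    _ = ∫ θ, ∑ j, pd j (F j) θ := by
        refine setIntegral_eq_integral_of_forall_compl_eq_zero fun θ hθ => ?_
        refine Finset.sum_eq_zero fun j _ => ?_
        rw [pd, (hFev0 j θ fun h => hθ (hKΩ h)).fderiv_eq]
        simp
    _ = 0 := by
        rw [integral_finsetSum _ fun j _ => ?_]
        · exact Finset.sum_eq_zero fun j _ => integral_pd_eq_zero (hFc j) (hFs j) j
        · exact (((hFc j).continuous_fderiv one_ne_zero).clm_apply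
            continuous_const).integrable_of_hasCompactSupport ((hFs j).fderiv_apply ℝ _)

end Divergence

/-! ### Local parametrizations and regularity read off in charts -/

section Charts

variable {n : ℕ} {k : WithTop ℕ∞} {N : Set (Euc (n + 1))} {Ω : Set (Euc n)}
  {Y : Euc n → Euc (n + 1)} {θ : Euc n}

namespace IsLocalParam

theorem mono {k' : WithTop ℕ∞} (hk : k' ≤ k) (hY : IsLocalParam k N Ω Y) :
    IsLocalParam k' N Ω Y :=
  ⟨hY.1, hY.2.of_le hk, hY.3, hY.4, hY.5⟩

theorem injOn (hY : IsLocalParam k N Ω Y) : InjOn Y Ω :=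
  injOn_iff_injective.2 hY.isEmbedding.injective

theorem mapsTo (hY : IsLocalParam k N Ω Y) : MapsTo Y Ω N := by
  obtain ⟨U, -, hU⟩ := hY.isOpen_image
  exact fun θ hθ => (hU ▸ mem_image_of_mem Y hθ : Y θ ∈ N ∩ U).1

theorem image_mem_nhdsWithin (hY : IsLocalParam k N Ω Y) (hθ : θ ∈ Ω) : Y '' Ω ∈ 𝓝[N] (Y θ) := by
  obtain ⟨U, hUo, hU⟩ := hY.isOpen_image
  rw [hU]
  exact inter_mem_nhdsWithin N (hUo.mem_nhds (hU ▸ mem_image_of_mem Y hθ : Y θ ∈ N ∩ U).2)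

/-- The embedding property gives neighbourhoods within the image, and relative openness makes them
neighbourhoods within `N`. Local statements on `N` thus become statements on open sets of `ℝⁿ`. -/
theorem map_nhds (hY : IsLocalParam k N Ω Y) (hθ : θ ∈ Ω) : map Y (𝓝 θ) = 𝓝[N] (Y θ) := by
  have h1 := hY.isEmbedding.map_nhds_eq ⟨θ, hθ⟩
  rw [range_domRestrict] at h1
  have h2 : map (Ω.domRestrict Y) (𝓝 ⟨θ, hθ⟩) = map Y (𝓝 θ) := by
    rw [domRestrict_eq, ← Filter.map_map,
      map_nhds_subtype_coe_eq_nhds hθ (hY.isOpen_source.mem_nhds hθ)]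
  rw [h2] at h1
  rw [h1]
  refine le_antisymm (nhdsWithin_mono _ hY.mapsTo.image_subset) ?_
  exact nhdsWithin_le_iff.2 (hY.image_mem_nhdsWithin hθ)

theorem eventually_iff (hY : IsLocalParam k N Ω Y) (hθ : θ ∈ Ω) {p : Euc (n + 1) → Prop} :
    (∀ᶠ q in 𝓝[N] (Y θ), p q) ↔ ∀ᶠ ϑ in 𝓝 θ, p (Y ϑ) := by
  rw [← hY.map_nhds hθ, Filter.eventually_map]

theorem continuousWithinAt_iff {W : Type*} [TopologicalSpace W] (hY : IsLocalParam k N Ω Y)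
    (hθ : θ ∈ Ω) {f : Euc (n + 1) → W} :
    ContinuousWithinAt f N (Y θ) ↔ ContinuousAt (f ∘ Y) θ := by
  rw [ContinuousWithinAt, ← hY.map_nhds hθ, tendsto_map'_iff, ContinuousAt, Function.comp_apply]

/-- Take a linear left inverse `π` of the derivative of `Y` at `θ`. By the inverse function theorem
`π ∘ Y` has a local `C¹` inverse `ψ`, and `f ∘ Y ∘ ψ ∘ π` is a `C¹` function on an ambient
neighbourhood that agrees with `f` on `N`. -/
theorem contDiffWithinAt {W : Type*} [NormedAddCommGroup W] [NormedSpace ℝ W]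
    (hY : IsLocalParam 1 N Ω Y) (hθ : θ ∈ Ω) {f : Euc (n + 1) → W}
    (hf : ContDiffAt ℝ 1 (f ∘ Y) θ) : ContDiffWithinAt ℝ 1 f N (Y θ) := by
  obtain ⟨π, hπ⟩ := LinearMap.exists_leftInverse_of_injective
    (fderiv ℝ Y θ : Euc n →ₗ[ℝ] Euc (n + 1)) (LinearMap.ker_eq_bot.2 (hY.immersion θ hθ))
  set π' : Euc (n + 1) →L[ℝ] Euc n := LinearMap.toContinuousLinearMap π with hπ'
  have hYθ : ContDiffAt ℝ 1 Y θ := hY.contDiffOn.contDiffAt (hY.isOpen_source.mem_nhds hθ)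
  have hcd : ContDiffAt ℝ 1 (π' ∘ Y) θ := π'.contDiff.contDiffAt.comp θ hYθ
  have hder : HasFDerivAt (π' ∘ Y) (ContinuousLinearEquiv.refl ℝ (Euc n) : Euc n →L[ℝ] Euc n) θ := by
    have := π'.hasFDerivAt.comp θ (hYθ.differentiableAt one_ne_zero).hasFDerivAt
    have e : (ContinuousLinearEquiv.refl ℝ (Euc n) : Euc n →L[ℝ] Euc n) =
        π' ∘SL fderiv ℝ Y θ := by
      refine ContinuousLinearMap.ext fun v => ?_
      exact (LinearMap.congr_fun hπ v).symm
    rwa [e]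
  have hinv := hcd.to_localInverse hder one_ne_zero
  have hleft := (hcd.hasStrictFDerivAt' hder one_ne_zero).eventually_left_inverse
  set ψ := hcd.localInverse hder one_ne_zero with hψ
  have hψθ : ψ (π' (Y θ)) = θ := hleft.self_of_nhds
  have hev : f =ᶠ[𝓝[N] (Y θ)] fun q => (f ∘ Y) (ψ (π' q)) := by
    refine (hY.eventually_iff hθ).2 ?_
    filter_upwards [hleft] with ϑ hϑ
    have : ψ (π' (Y ϑ)) = ϑ := hϑ
    simp [this]
  have hcomp : ContDiffAt ℝ 1 (fun q => (f ∘ Y) (ψ (π' q))) (Y θ) := by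
    have h1 : ContDiffAt ℝ 1 (fun q => ψ (π' q)) (Y θ) :=
      ContDiffAt.comp (Y θ) hinv π'.contDiff.contDiffAt
    refine ContDiffAt.comp (g := f ∘ Y) (f := fun q => ψ (π' q)) (Y θ) ?_ h1
    rwa [hψθ]
  exact hcomp.contDiffWithinAt.congr_of_eventuallyEq hev (by simp [hψθ])

theorem contDiffOn_comp {W : Type*} [NormedAddCommGroup W] [NormedSpace ℝ W]
    (hY : IsLocalParam 1 N Ω Y) {f : Euc (n + 1) → W} (hf : ContDiffOn ℝ 1 f N) :
    ContDiffOn ℝ 1 (f ∘ Y) Ω :=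
  hf.comp hY.contDiffOn hY.mapsTo

end IsLocalParam

/-- The image of a parametrized hypersurface under an embedding. -/
theorem IsEmbeddingOn.isLocalParam_comp {M : Set (Euc (n + 1))} {y : Euc (n + 1) → Euc (n + 1)}
    {X : Euc n → Euc (n + 1)} (hy : IsEmbeddingOn 2 M y) (hX : IsLocalParam ∞ M Ω X) :
    IsLocalParam 2 (y '' M) Ω (y ∘ X) where
  isOpen_source := hX.isOpen_source
  contDiffOn := hy.contDiffOn.comp (hX.contDiffOn.of_le (WithTop.coe_le_coe.2 (le_top : (2 : ℕ∞) ≤ ⊤))) hX.mapsTo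
  immersion := hy.immersion Ω X hX
  isEmbedding := by
    have h1 : ∀ θ, Ω.domRestrict X θ ∈ M := fun θ => hX.mapsTo θ.2
    exact hy.isEmbedding.comp (hX.isEmbedding.codRestrict M h1)
  isOpen_image := by
    obtain ⟨U, hUo, hU⟩ := hX.isOpen_image
    obtain ⟨V, hVo, hV⟩ := hy.isEmbedding.isOpen_iff.1 (hUo.preimage continuous_subtype_val :
      IsOpen ((↑) ⁻¹' U : Set M))
    refine ⟨V, hVo, ?_⟩
    have hV' : ∀ p ∈ M, y p ∈ V ↔ p ∈ U := fun p hp => by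
      have := Set.ext_iff.1 hV ⟨p, hp⟩
      simpa using this
    rw [image_comp, hU]
    ext q
    constructor
    · rintro ⟨p, ⟨hp, hpU⟩, rfl⟩
      exact ⟨mem_image_of_mem y hp, (hV' p hp).2 hpU⟩
    · rintro ⟨⟨p, hp, rfl⟩, hqV⟩
      exact ⟨p, ⟨hp, (hV' p hp).1 hqV⟩, rfl⟩

theorem IsEmbeddingOn.isHypersurface_image {M : Set (Euc (n + 1))}
    {y : Euc (n + 1) → Euc (n + 1)} (hy : IsEmbeddingOn 2 M y) (hM : IsHypersurface ∞ M) :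
    IsHypersurface 2 (y '' M) := by
  rintro _ ⟨p, hp, rfl⟩
  obtain ⟨Ω, X, hX, θ, hθ, rfl⟩ := hM p hp
  exact ⟨Ω, y ∘ X, hy.isLocalParam_comp hX, θ, hθ, rfl⟩

theorem IsHypersurface.mono {k' : WithTop ℕ∞} (hN : IsHypersurface k N) (hk : k' ≤ k) :
    IsHypersurface k' N := fun p hp => by
  obtain ⟨Ω, X, hX, h⟩ := hN p hp
  exact ⟨Ω, X, hX.mono hk, h⟩

theorem IsHypersurface.continuousOn {W : Type*} [TopologicalSpace W] (hN : IsHypersurface k N)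
    {f : Euc (n + 1) → W} (hf : ∀ (Ω : Set (Euc n)) (Y : Euc n → Euc (n + 1)),
      IsLocalParam k N Ω Y → ContinuousOn (f ∘ Y) Ω) : ContinuousOn f N := by
  intro p hp
  obtain ⟨Ω, Y, hY, θ, hθ, rfl⟩ := hN p hp
  exact (hY.continuousWithinAt_iff hθ).2
    ((hf Ω Y hY).continuousAt (hY.isOpen_source.mem_nhds hθ))

theorem IsHypersurface.contDiffOn {W : Type*} [NormedAddCommGroup W] [NormedSpace ℝ W]
    (hN : IsHypersurface k N) (hk : 1 ≤ k)
    {f : Euc (n + 1) → W} (hf : ∀ (Ω : Set (Euc n)) (Y : Euc n → Euc (n + 1)),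
      IsLocalParam k N Ω Y → ContDiffOn ℝ 1 (f ∘ Y) Ω) : ContDiffOn ℝ 1 f N := by
  intro p hp
  obtain ⟨Ω, Y, hY, θ, hθ, rfl⟩ := hN p hp
  exact (hY.mono hk).contDiffWithinAt hθ
    ((hf Ω Y hY).contDiffAt (hY.isOpen_source.mem_nhds hθ))

end Charts

/-! ### Tangential gradients in local coordinates -/

section TangentialGradient

variable {n : ℕ} {N : Set (Euc (n + 1))} {Ω : Set (Euc n)}
  {Y : Euc n → Euc (n + 1)} {θ : Euc n} {ν : Euc (n + 1) → Euc (n + 1)}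

/-- The Jacobian matrix `(∂ⱼF_β)`. -/
noncomputable def jac {m : ℕ} (F : Euc n → Euc m) (θ : Euc n) : Matrix (Fin m) (Fin n) ℝ :=
  Matrix.of fun β j => pd j F θ β

theorem inducedMetric_eq {m : ℕ} (F : Euc n → Euc m) (θ : Euc n) :
    inducedMetric F θ = (jac F θ)ᵀ * jac F θ := by
  ext i j
  simp [inducedMetric, jac, Matrix.mul_apply, PiLp.inner_apply, mul_comm]

theorem inducedMetric_transpose {m : ℕ} (F : Euc n → Euc m) (θ : Euc n) :
    (inducedMetric F θ)ᵀ = inducedMetric F θ := by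
  rw [inducedMetric_eq, Matrix.transpose_mul, Matrix.transpose_transpose]

theorem det_inducedMetric_pos {m : ℕ} {F : Euc n → Euc m}
    (h : Function.Injective (fderiv ℝ F θ)) : 0 < (inducedMetric F θ).det :=
  Real.sqrt_pos.1 (areaElement_pos h)

theorem isUnit_det_jac {m : ℕ} {F : Euc n → Euc m} (h : Function.Injective (fderiv ℝ F θ)) :
    IsUnit ((jac F θ)ᵀ * jac F θ).det := by
  rw [← inducedMetric_eq]
  exact isUnit_iff_ne_zero.2 (det_inducedMetric_pos h).ne'

theorem contDiffOn_jac {m : ℕ} {F : Euc n → Euc m} (hΩ : IsOpen Ω) (hF : ContDiffOn ℝ 2 F Ω)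
    (β : Fin m) (j : Fin n) : ContDiffOn ℝ 1 (fun θ => jac F θ β j) Ω :=
  contDiffOn_euclidean.1 (contDiffOn_pd hΩ hF j) β

theorem continuousOn_jac {m : ℕ} {F : Euc n → Euc m} (hΩ : IsOpen Ω) (hF : ContDiffOn ℝ 1 F Ω) :
    ContinuousOn (jac F) Ω :=
  continuousOn_pi.2 fun β => continuousOn_pi.2 fun j =>
    (EuclideanSpace.proj β : Euc m →L[ℝ] ℝ).continuous.comp_continuousOn (continuousOn_pd hΩ hF j)

theorem contDiffOn_inducedMetric {m : ℕ} {F : Euc n → Euc m} (hΩ : IsOpen Ω)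
    (hF : ContDiffOn ℝ 2 F Ω) (i j : Fin n) :
    ContDiffOn ℝ 1 (fun θ => inducedMetric F θ i j) Ω :=
  (contDiffOn_pd hΩ hF i).inner ℝ (contDiffOn_pd hΩ hF j)

theorem _root_.ContinuousOn.matrix_mul {Z a b c : Type*} [TopologicalSpace Z] [Fintype b]
    {S : Set Z} {f : Z → Matrix a b ℝ} {g : Z → Matrix b c ℝ} (hf : ContinuousOn f S)
    (hg : ContinuousOn g S) : ContinuousOn (fun z => f z * g z) S :=
  (Continuous.matrix_mul continuous_fst continuous_snd).comp_continuousOn (hf.prodMk hg)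

theorem continuousOn_inv_matrix {Z : Type*} [TopologicalSpace Z] {S : Set Z} {k : ℕ}
    {g : Z → Matrix (Fin k) (Fin k) ℝ}
    (hg : ContinuousOn g S) (hdet : ∀ z ∈ S, (g z).det ≠ 0) :
    ContinuousOn (fun z => (g z)⁻¹) S := by
  simp only [Matrix.inv_def, Ring.inverse_eq_inv']
  exact ((Continuous.matrix_det continuous_id).comp_continuousOn hg |>.inv₀ hdet).smul
    ((Continuous.matrix_adjugate continuous_id).comp_continuousOn hg)

theorem IsUnitNormal.dotProduct_self (hν : IsUnitNormal N ν) {q : Euc (n + 1)} (hq : q ∈ N) :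
    (ν q).ofLp ⬝ᵥ (ν q).ofLp = 1 := by
  have h1 : ⟪ν q, ν q⟫ = 1 := by rw [real_inner_self_eq_norm_sq, hν.1 q hq, one_pow]
  rw [PiLp.inner_apply] at h1
  simpa only [dotProduct, RCLike.inner_apply, conj_trivial] using h1

theorem IsUnitNormal.jac_transpose_mulVec (hν : IsUnitNormal N ν) (hY : IsLocalParam 1 N Ω Y)
    (hθ : θ ∈ Ω) : (jac Y θ)ᵀ *ᵥ (ν (Y θ)).ofLp = 0 := by
  ext j
  have := hν.2 Ω Y hY θ hθ (EuclideanSpace.single j 1)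
  simpa [jac, Matrix.mulVec, dotProduct, PiLp.inner_apply, pd, mul_comm] using this

theorem IsUnitNormal.tangent_add_normal (hν : IsUnitNormal N ν) (hY : IsLocalParam 1 N Ω Y)
    (hθ : θ ∈ Ω) :
    jac Y θ * ((jac Y θ)ᵀ * jac Y θ)⁻¹ * (jac Y θ)ᵀ +
      Matrix.vecMulVec (ν (Y θ)).ofLp (ν (Y θ)).ofLp = 1 :=
  tangent_add_normal_eq_one (hν.dotProduct_self (hY.mapsTo hθ)) (hν.jac_transpose_mulVec hY hθ)
    (isUnit_det_jac (hY.immersion θ hθ))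

/-- The tangential projection of a basis vector in local coordinates. -/
theorem proj_single_eq_fderiv (hν : IsUnitNormal N ν) (hY : IsLocalParam 1 N Ω Y)
    (hθ : θ ∈ Ω) (γ : Fin (n + 1)) :
    proj (ν (Y θ)) (EuclideanSpace.single γ 1) =
      ∑ j, (((jac Y θ)ᵀ * jac Y θ)⁻¹ * (jac Y θ)ᵀ) j γ •
        fderiv ℝ Y θ (EuclideanSpace.single j 1) := by
  ext β
  have h1 := congrFun (congrFun (hν.tangent_add_normal hY hθ) β) γ
  rw [Matrix.add_apply, Matrix.mul_assoc, Matrix.mul_apply, Matrix.vecMulVec_apply,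
    ← eq_sub_iff_add_eq] at h1
  simp only [proj, PiLp.sub_apply, PiLp.smul_apply, smul_eq_mul, WithLp.ofLp_sum,
    Finset.sum_apply, EuclideanSpace.inner_single_right, WithLp.ofLp_smul, Pi.smul_apply]
  simp only [jac, Matrix.of_apply, pd] at h1 ⊢
  calc _ = (1 : Matrix (Fin (n + 1)) (Fin (n + 1)) ℝ) β γ - (ν (Y θ)) β * (ν (Y θ)) γ := by
        simp [Matrix.one_apply, mul_comm]
    _ = _ := by
        rw [← h1]
        exact Finset.sum_congr rfl fun j _ => mul_comm _ _

/-- A derivative within `N` is not unique on the ambient space, but the chain rule along `Y` fixes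
its values on tangent vectors. -/
theorem fderivWithin_comp_param {W : Type*} [NormedAddCommGroup W] [NormedSpace ℝ W]
    (hY : IsLocalParam 1 N Ω Y) (hθ : θ ∈ Ω) {f : Euc (n + 1) → W}
    (hf : DifferentiableWithinAt ℝ f N (Y θ)) (v : Euc n) :
    fderivWithin ℝ f N (Y θ) (fderiv ℝ Y θ v) = fderiv ℝ (f ∘ Y) θ v := by
  have hnhds := hY.isOpen_source.mem_nhds hθ
  have h1 : HasFDerivAt Y (fderiv ℝ Y θ) θ :=
    ((hY.contDiffOn.contDiffAt hnhds).differentiableAt one_ne_zero).hasFDerivAt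
  have h2 := (hf.hasFDerivWithinAt.comp θ h1.hasFDerivWithinAt hY.mapsTo).hasFDerivAt hnhds
  rw [h2.fderiv, ContinuousLinearMap.comp_apply]

/-- The tangential gradient in local coordinates. -/
theorem tangGrad_param (hν : IsUnitNormal N ν) (hY : IsLocalParam 1 N Ω Y) (hθ : θ ∈ Ω)
    {f : Euc (n + 1) → Euc (n + 1)} (hf : DifferentiableWithinAt ℝ f N (Y θ)) :
    tangGrad N ν f (Y θ) =
      jac (f ∘ Y) θ * ((jac Y θ)ᵀ * jac Y θ)⁻¹ * (jac Y θ)ᵀ := by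
  ext β γ
  rw [tangGrad, Matrix.of_apply, proj_single_eq_fderiv hν hY hθ, map_sum, Matrix.mul_assoc,
    Matrix.mul_apply]
  simp only [map_smul, fderivWithin_comp_param hY hθ hf, WithLp.ofLp_sum, Finset.sum_apply,
    WithLp.ofLp_smul, Pi.smul_apply, smul_eq_mul]
  exact Finset.sum_congr rfl fun j _ => mul_comm _ _

theorem continuousOn_tangGrad (hN : IsHypersurface 1 N) (hν : IsUnitNormal N ν)
    {f : Euc (n + 1) → Euc (n + 1)} (hf : ContDiffOn ℝ 1 f N) :
    ContinuousOn (tangGrad N ν f) N := by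
  refine hN.continuousOn fun Ω Y hY => ?_
  have h1 : ContinuousOn (jac Y) Ω := continuousOn_jac hY.isOpen_source hY.contDiffOn
  have h2 : ContinuousOn (jac (f ∘ Y)) Ω :=
    continuousOn_jac hY.isOpen_source (hY.contDiffOn_comp hf)
  have h3 : ContinuousOn (fun θ => (jac Y θ)ᵀ) Ω := continuous_id.matrix_transpose.comp_continuousOn h1
  have h4 : ContinuousOn (fun θ => ((jac Y θ)ᵀ * jac Y θ)⁻¹) Ω :=
    continuousOn_inv_matrix (h3.matrix_mul h1) fun θ hθ => (isUnit_det_jac (hY.immersion θ hθ)).ne_zero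
  refine ((h2.matrix_mul h4).matrix_mul h3).congr fun θ hθ => ?_
  exact tangGrad_param hν hY hθ (hf.differentiableOn one_ne_zero _ (hY.mapsTo hθ))

/-- On a hypersurface of class `C²`, the projection `ν ⊗ ν` is of class `C¹`. -/
theorem contDiffOn_normal_mul (hN : IsHypersurface 2 N) (hν : IsUnitNormal N ν)
    (β γ : Fin (n + 1)) : ContDiffOn ℝ 1 (fun q => ν q β * ν q γ) N := by
  refine hN.contDiffOn (by norm_num) fun Ω Y hY => ?_
  have hY1 : IsLocalParam 1 N Ω Y := hY.mono (by norm_num)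
  -- No regularity of `ν` is assumed, and even its sign may jump. Completeness expresses `ν ⊗ ν`
  -- through first derivatives of the `C²` chart.
  have h1 : ContDiffOn ℝ 1 (fun θ => (1 : Matrix (Fin (n + 1)) (Fin (n + 1)) ℝ) β γ -
      ∑ j, (∑ i, jac Y θ β i * (inducedMetric Y θ)⁻¹ i j) * jac Y θ γ j) Ω := by
    refine contDiffOn_const.sub (ContDiffOn.sum fun j _ => ContDiffOn.mul
      (ContDiffOn.sum fun i _ => ContDiffOn.mul ?_ ?_) ?_)
    · exact contDiffOn_jac hY.isOpen_source hY.contDiffOn _ _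
    · exact contDiffOn_inv_matrix (contDiffOn_inducedMetric hY.isOpen_source hY.contDiffOn)
        (fun θ hθ => (det_inducedMetric_pos (hY.immersion θ hθ)).ne') i j
    · exact contDiffOn_jac hY.isOpen_source hY.contDiffOn _ _
  refine h1.congr fun θ hθ => ?_
  rw [← hν.tangent_add_normal hY1 hθ, Matrix.add_apply, Matrix.vecMulVec_apply, inducedMetric_eq]
  simp [Matrix.mul_apply]

end TangentialGradient

/-! ### The inverse embedding and the matrix field `Ĥ` -/

section InverseEmbedding

variable {n : ℕ} {M : Set (Euc (n + 1))} {Ω : Set (Euc n)} {X : Euc n → Euc (n + 1)} {θ : Euc n}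
  {y ν : Euc (n + 1) → Euc (n + 1)}

theorem IsEmbeddingOn.injOn {k : WithTop ℕ∞} (hy : IsEmbeddingOn k M y) : InjOn y M :=
  injOn_iff_injective.2 hy.isEmbedding.injective

theorem IsEmbeddingOn.invFunOn_apply {k : WithTop ℕ∞} (hy : IsEmbeddingOn k M y) {p : Euc (n + 1)}
    (hp : p ∈ M) : Function.invFunOn y M (y p) = p :=
  hy.injOn.leftInvOn_invFunOn hp

theorem IsEmbeddingOn.invFunOn_comp_eventuallyEq (hy : IsEmbeddingOn 2 M y)
    (hX : IsLocalParam ∞ M Ω X) (hθ : θ ∈ Ω) :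
    Function.invFunOn y M ∘ (y ∘ X) =ᶠ[𝓝 θ] X := by
  filter_upwards [hX.isOpen_source.mem_nhds hθ] with ϑ hϑ
  exact hy.invFunOn_apply (hX.mapsTo hϑ)

/-- Read in the chart `y ∘ X` of the image, the inverse of `y` is the smooth map `X`. -/
theorem IsEmbeddingOn.contDiffOn_invFunOn (hy : IsEmbeddingOn 2 M y) (hM : IsHypersurface ∞ M) :
    ContDiffOn ℝ 1 (Function.invFunOn y M) (y '' M) := by
  rintro _ ⟨p, hp, rfl⟩
  obtain ⟨Ω, X, hX, θ, hθ, rfl⟩ := hM p hp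
  refine ((hy.isLocalParam_comp hX).mono (by norm_num)).contDiffWithinAt hθ ?_
  exact ((hX.contDiffOn.contDiffAt (hX.isOpen_source.mem_nhds hθ)).of_le
    (by exact_mod_cast le_top)).congr_of_eventuallyEq (hy.invFunOn_comp_eventuallyEq hX hθ)

/-- For the same reason the Jacobian of the pulled-back inverse is that of `X`, so the Gram matrix
of `X` appears in the middle. -/
theorem hMat_param (hM : IsHypersurface ∞ M) (hy : IsEmbeddingOn 2 M y)
    (hν : IsUnitNormal (y '' M) ν) (hX : IsLocalParam ∞ M Ω X) (hθ : θ ∈ Ω) :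
    HMat M y ν (y (X θ)) =
      jac (y ∘ X) θ * (((jac (y ∘ X) θ)ᵀ * jac (y ∘ X) θ)⁻¹ * ((jac X θ)ᵀ * jac X θ) *
        ((jac (y ∘ X) θ)ᵀ * jac (y ∘ X) θ)⁻¹) * (jac (y ∘ X) θ)ᵀ +
      Matrix.vecMulVec (ν (y (X θ))).ofLp (ν (y (X θ))).ofLp := by
  have hY := (hy.isLocalParam_comp hX).mono (k' := 1) (by norm_num)
  have h1 : tangGrad (y '' M) ν (Function.invFunOn y M) (y (X θ)) = _ :=
    tangGrad_param hν hY hθ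
    ((hy.contDiffOn_invFunOn hM).differentiableOn one_ne_zero _ (hY.mapsTo hθ))
  have h2 : jac (Function.invFunOn y M ∘ (y ∘ X)) θ = jac X θ := by
    ext β j
    simp only [jac, pd, Matrix.of_apply, (hy.invFunOn_comp_eventuallyEq hX hθ).fderiv_eq]
  rw [HMat, h1, h2, hMat_algebra]
  rfl

theorem det_hMat_param (hM : IsHypersurface ∞ M) (hy : IsEmbeddingOn 2 M y)
    (hν : IsUnitNormal (y '' M) ν) (hX : IsLocalParam ∞ M Ω X) (hθ : θ ∈ Ω) :
    (HMat M y ν (y (X θ))).det =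
      (inducedMetric X θ).det / (inducedMetric (y ∘ X) θ).det := by
  have hY := (hy.isLocalParam_comp hX).mono (k' := 1) (by norm_num)
  rw [hMat_param hM hy hν hX hθ, inducedMetric_eq, inducedMetric_eq]
  exact det_hMat_algebra (hν.dotProduct_self (hY.mapsTo hθ))
    (hν.jac_transpose_mulVec hY hθ) (isUnit_det_jac (hY.immersion θ hθ)) _

theorem inv_hMat_param (hM : IsHypersurface ∞ M) (hy : IsEmbeddingOn 2 M y)
    (hν : IsUnitNormal (y '' M) ν) (hX : IsLocalParam ∞ M Ω X) (hθ : θ ∈ Ω) :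
    (HMat M y ν (y (X θ)))⁻¹ = jac (y ∘ X) θ * (inducedMetric X θ)⁻¹ * (jac (y ∘ X) θ)ᵀ +
      Matrix.vecMulVec (ν (y (X θ))).ofLp (ν (y (X θ))).ofLp := by
  have hY := (hy.isLocalParam_comp hX).mono (k' := 1) (by norm_num)
  rw [hMat_param hM hy hν hX hθ, inducedMetric_eq]
  exact inv_hMat_algebra (hν.dotProduct_self (hY.mapsTo hθ))
    (hν.jac_transpose_mulVec hY hθ) (isUnit_det_jac (hY.immersion θ hθ))
    (isUnit_det_jac (hX.immersion θ hθ))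

theorem sqrt_det_hMat (hM : IsHypersurface ∞ M) (hy : IsEmbeddingOn 2 M y)
    (hν : IsUnitNormal (y '' M) ν) (hX : IsLocalParam ∞ M Ω X) (hθ : θ ∈ Ω) :
    √(HMat M y ν (y (X θ))).det = volumeRatio X (y ∘ X) θ := by
  rw [det_hMat_param hM hy hν hX hθ, volumeRatio,
    Real.sqrt_div (det_inducedMetric_pos (hX.immersion θ hθ)).le]

theorem det_hMat_pos (hM : IsHypersurface ∞ M) (hy : IsEmbeddingOn 2 M y)
    (hν : IsUnitNormal (y '' M) ν) {q : Euc (n + 1)} (hq : q ∈ y '' M) :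
    0 < (HMat M y ν q).det := by
  obtain ⟨p, hp, rfl⟩ := hq
  obtain ⟨Ω, X, hX, θ, hθ, rfl⟩ := hM p hp
  rw [det_hMat_param hM hy hν hX hθ]
  exact div_pos (det_inducedMetric_pos (hX.immersion θ hθ))
    (det_inducedMetric_pos (hy.immersion Ω X hX θ hθ))

theorem continuousOn_hMat (hM : IsHypersurface ∞ M) (hy : IsEmbeddingOn 2 M y)
    (hν : IsUnitNormal (y '' M) ν) : ContinuousOn (HMat M y ν) (y '' M) := by
  have hN := hy.isHypersurface_image hM
  have h1 := continuousOn_tangGrad (hN.mono (by norm_num)) hν (hy.contDiffOn_invFunOn hM)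
  refine ((continuous_id.matrix_transpose.comp_continuousOn h1).mul h1).add ?_
  exact continuousOn_pi.2 fun β => continuousOn_pi.2 fun γ =>
    (contDiffOn_normal_mul hN hν β γ).continuousOn

end InverseEmbedding

/-! ### Surface integrals and integration by parts on a coordinate patch -/

section SurfaceIntegrals

variable {n : ℕ} {N : Set (Euc (n + 1))} {Ω : Set (Euc n)}
  {Y : Euc n → Euc (n + 1)} {θ : Euc n} {ν : Euc (n + 1) → Euc (n + 1)}

theorem IsLocalParam.measurableSet_image (hY : IsLocalParam 1 N Ω Y) : MeasurableSet (Y '' Ω) :=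
  hY.isOpen_source.measurableSet.image_of_continuousOn_injOn hY.contDiffOn.continuousOn hY.injOn

theorem IsLocalParam.continuousOn_image {W : Type*} [TopologicalSpace W]
    (hY : IsLocalParam 1 N Ω Y) {f : Euc (n + 1) → W} (hf : ContinuousOn (f ∘ Y) Ω) :
    ContinuousOn f (Y '' Ω) := by
  rintro _ ⟨θ, hθ, rfl⟩
  exact ((hY.continuousWithinAt_iff hθ).2
    (hf.continuousAt (hY.isOpen_source.mem_nhds hθ))).mono hY.mapsTo.image_subset

/-- Integrals over the image of a parametrization. -/
theorem IsLocalParam.integral_image (hY : IsLocalParam 1 N Ω Y) {F : Euc (n + 1) → ℝ}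
    (hF : ContinuousOn F (Y '' Ω)) :
    ∫ q in Y '' Ω, F q ∂(μHE[n] : Measure (Euc (n + 1))) =
      ∫ θ in Ω, areaElement Y θ * F (Y θ) := by
  have hmap := map_withDensity_areaElement hY.isOpen_source hY.contDiffOn hY.immersion hY.injOn
  have hae := aemeasurable_withDensity_restrict hY.isOpen_source hY.contDiffOn.continuousOn
    fun ϑ => ENNReal.ofReal (areaElement Y ϑ)
  have hJ : AEMeasurable (fun ϑ => ENNReal.ofReal (areaElement Y ϑ)) (volume.restrict Ω) :=
    ((continuousOn_areaElement hY.isOpen_source hY.contDiffOn).aemeasurable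
      hY.isOpen_source.measurableSet).ennreal_ofReal
  rw [← hmap, integral_map hae, integral_withDensity_eq_integral_toReal_smul₀ hJ]
  · refine integral_congr_ae (Eventually.of_forall fun θ => ?_)
    simp [areaElement, ENNReal.toReal_ofReal (Real.sqrt_nonneg _)]
  · exact Eventually.of_forall fun θ => ENNReal.ofReal_lt_top
  · rw [hmap]
    exact hF.aestronglyMeasurable hY.measurableSet_image

/-- Each point has a neighbourhood in `N` that is the image of a closed ball; its area is the
integral of a continuous function over a compact set. -/
theorem IsHypersurface.euclideanHausdorffMeasure_lt_top (hN : IsHypersurface 1 N)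
    (hc : IsCompact N) : μHE[n] N < ⊤ := by
  refine hc.measure_lt_top_of_nhdsWithin fun q hq => ?_
  obtain ⟨Ω, Y, hY, θ, hθ, rfl⟩ := hN q hq
  obtain ⟨r, hr, hball⟩ := Metric.nhds_basis_closedBall.mem_iff.1 (hY.isOpen_source.mem_nhds hθ)
  refine ⟨Y '' Metric.closedBall θ r, ?_, ?_⟩
  · rw [← hY.map_nhds hθ]
    exact image_mem_map (Metric.closedBall_mem_nhds θ hr)
  · rw [euclideanHausdorffMeasure_image_eq hY.isOpen_source hY.contDiffOn hY.immersion hY.injOn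
      hball Metric.isClosed_closedBall.measurableSet]
    exact (((continuousOn_areaElement hY.isOpen_source hY.contDiffOn).mono
      hball).integrableOn_compact (isCompact_closedBall θ r)).lintegral_lt_top

theorem isFiniteMeasure_surf (hN : IsHypersurface 1 N) (hc : IsCompact N) :
    IsFiniteMeasure (surf N) :=
  ⟨by rw [surf, Measure.restrict_apply_univ]; exact hN.euclideanHausdorffMeasure_lt_top hc⟩

theorem integrable_surf {W : Type*} [NormedAddCommGroup W] (hN : IsHypersurface 1 N)
    (hc : IsCompact N) {f : Euc (n + 1) → W} (hf : ContinuousOn f N) : Integrable f (surf N) :=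
  hf.integrableOn_of_subset_isCompact hc hc.measurableSet Subset.rfl
    (hN.euclideanHausdorffMeasure_lt_top hc).ne

theorem continuousOn_laplacian {m : ℕ} {F : Euc n → Euc m} (hΩ : IsOpen Ω)
    {g : Euc n → Matrix (Fin n) (Fin n) ℝ}
    (hg : ∀ i j, ContDiffOn ℝ 1 (fun θ => g θ i j) Ω) (hdet : ∀ θ ∈ Ω, 0 < (g θ).det)
    (hF : ContDiffOn ℝ 2 F Ω) : ContinuousOn (laplacian g F) Ω := by
  have hinv := fun i j => (contDiffOn_inv_matrix hg (fun θ hθ => (hdet θ hθ).ne') i j).continuousOn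
  have hpg := fun l i j => continuousOn_pd hΩ (hg i j) l
  have hpF := fun i => (contDiffOn_pd hΩ hF i)
  refine continuousOn_finsetSum _ fun i _ => continuousOn_finsetSum _ fun j _ => ?_
  refine (hinv i j).smul ((continuousOn_pd hΩ (hpF j) i).sub ?_)
  refine continuousOn_finsetSum _ fun k _ => ?_
  suffices h : ContinuousOn (christoffel g k i j) Ω from h.smul (hpF k).continuousOn
  refine continuousOn_const.mul (continuousOn_finsetSum _ fun l _ => (hinv k l).mul ?_)
  exact ((hpg i l j).add (hpg j l i)).sub (hpg l i j)

theorem trace_jac_mul {m : ℕ} (F G : Euc n → Euc m) (L : Matrix (Fin n) (Fin n) ℝ) (θ : Euc n) :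
    (jac F θ * L * (jac G θ)ᵀ).trace = ∑ i, ∑ j, L i j * ⟪pd i F θ, pd j G θ⟫ := by
  simp only [Matrix.trace, Matrix.diag, Matrix.mul_apply, Matrix.transpose_apply, jac,
    Matrix.of_apply, PiLp.inner_apply, RCLike.inner_apply, conj_trivial, Finset.sum_mul,
    Finset.mul_sum]
  rw [Finset.sum_comm, Finset.sum_congr rfl fun j _ => Finset.sum_comm, Finset.sum_comm]
  refine Finset.sum_congr rfl fun i _ => Finset.sum_congr rfl fun j _ =>
    Finset.sum_congr rfl fun β _ => ?_
  ring

theorem continuousOn_dotdotWith {Z : Type*} [TopologicalSpace Z] {S : Set Z} {m : ℕ}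
    {K A B : Z → Matrix (Fin m) (Fin m) ℝ} (hK : ContinuousOn K S) (hA : ContinuousOn A S)
    (hB : ContinuousOn B S) : ContinuousOn (fun z => dotdotWith (K z) (A z) (B z)) S := by
  have h : ∀ {f : Z → Matrix (Fin m) (Fin m) ℝ}, ContinuousOn f S → ∀ i j,
      ContinuousOn (fun z => f z i j) S := fun hf i j =>
    continuousOn_pi.1 (continuousOn_pi.1 hf i) j
  exact continuousOn_finsetSum _ fun γ _ => continuousOn_finsetSum _ fun κ _ =>
    continuousOn_finsetSum _ fun β _ => ((h hK γ κ).mul (h hA β γ)).mul (h hB β κ)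

/-- Integration by parts on the image of a parametrization, for test functions that are compactly
supported there. -/
theorem integral_image_by_parts (hν : IsUnitNormal N ν) (hN : IsHypersurface 1 N)
    (hY : IsLocalParam 2 N Ω Y) {g : Euc n → Matrix (Fin n) (Fin n) ℝ}
    (hsymm : ∀ θ, (g θ)ᵀ = g θ) (hg : ∀ i j, ContDiffOn ℝ 1 (fun θ => g θ i j) Ω)
    (hdet : ∀ θ ∈ Ω, 0 < (g θ).det)
    {K : Euc (n + 1) → Matrix (Fin (n + 1)) (Fin (n + 1)) ℝ} {w : Euc (n + 1) → ℝ}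
    (hKc : ContinuousOn K N) (hwc : ContinuousOn w N)
    (hK : ∀ θ ∈ Ω, K (Y θ) = jac Y θ * (g θ)⁻¹ * (jac Y θ)ᵀ +
      Matrix.vecMulVec (ν (Y θ)).ofLp (ν (Y θ)).ofLp)
    (hw : ∀ θ ∈ Ω, areaElement Y θ * w (Y θ) = √(g θ).det)
    {L : Euc (n + 1) → Euc (n + 1)} (hL : ∀ θ ∈ Ω, L (Y θ) = laplacian g Y θ)
    {φ : Euc (n + 1) → Euc (n + 1)} (hφ : ContDiffOn ℝ 1 φ N)
    {C : Set (Euc n)} (hC : IsCompact C) (hCΩ : C ⊆ Ω) (hφC : ∀ θ ∈ Ω, θ ∉ C → φ (Y θ) = 0) :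
    ∫ q in Y '' Ω, (dotdotWith (K q) (tangGrad N ν (fun q => q) q) (tangGrad N ν φ q) * w q +
      w q * ⟪L q, φ q⟫) ∂(μHE[n] : Measure (Euc (n + 1))) = 0 := by
  have hY1 : IsLocalParam 1 N Ω Y := hY.mono (by norm_num)
  have hsub := hY.mapsTo.image_subset
  have hLc : ContinuousOn L (Y '' Ω) := by
    refine hY1.continuousOn_image ?_
    exact (continuousOn_laplacian hY.isOpen_source hg hdet hY.contDiffOn).congr hL
  have hid : ContDiffOn ℝ 1 (fun q : Euc (n + 1) => q) N := contDiffOn_id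
  rw [hY1.integral_image]
  · rw [← integral_laplacian_by_parts hY.isOpen_source hsymm hg hdet hY.contDiffOn
      (hY1.contDiffOn_comp hφ) hC hCΩ hφC]
    refine setIntegral_congr_fun hY.isOpen_source.measurableSet fun θ hθ => ?_
    simp only [Function.comp_apply]
    rw [tangGrad_param hν hY1 hθ (hφ.differentiableOn one_ne_zero _ (hY.mapsTo hθ)),
      tangGrad_param hν hY1 hθ (hid.differentiableOn one_ne_zero _ (hY.mapsTo hθ)), hK θ hθ,
      hL θ hθ, ← hw θ hθ]
    -- The form of `K` leaves `gⁱʲ ∂ᵢY · ∂ⱼ(φ ∘ Y)`, and the weight has turned the area element of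
    -- `Y` into `√det g`. The metric `g` need not be the one induced by `Y`.
    have hd := dotdotWith_tangent (hν.jac_transpose_mulVec hY1 hθ)
      (isUnit_det_jac (hY.immersion θ hθ)) (g θ)⁻¹ (jac (φ ∘ Y) θ)
    rw [trace_jac_mul] at hd
    have e : (fun q : Euc (n + 1) => q) ∘ Y = Y := rfl
    rw [e, hd]
    ring
  · refine ContinuousOn.add ?_ ?_
    · exact ((continuousOn_dotdotWith hKc (continuousOn_tangGrad hN hν hid)
        (continuousOn_tangGrad hN hν hφ)).mul hwc).mono hsub
    · exact (hwc.mono hsub).mul (hLc.inner (hφ.continuousOn.mono hsub))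

end SurfaceIntegrals

/-! ### Partition of unity and cut-off Laplacians -/

section Globalization

variable {n : ℕ} {N : Set (Euc (n + 1))} {Ω : Set (Euc n)}
  {Y : Euc n → Euc (n + 1)} {θ : Euc n} {ν : Euc (n + 1) → Euc (n + 1)}

theorem tangGrad_sum (hN : IsHypersurface 1 N) (hν : IsUnitNormal N ν) {ι : Type*} (s : Finset ι)
    {f : ι → Euc (n + 1) → Euc (n + 1)} (hf : ∀ i ∈ s, ContDiffOn ℝ 1 (f i) N)
    {q : Euc (n + 1)} (hq : q ∈ N) :
    tangGrad N ν (fun q => ∑ i ∈ s, f i q) q = ∑ i ∈ s, tangGrad N ν (f i) q := by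
  obtain ⟨Ω, Y, hY, θ, hθ, rfl⟩ := hN q hq
  rw [tangGrad_param hν hY hθ ((ContDiffOn.sum hf).differentiableOn one_ne_zero _ hq)]
  rw [Finset.sum_congr rfl fun i hi =>
    tangGrad_param hν hY hθ ((hf i hi).differentiableOn one_ne_zero _ hq)]
  suffices h : jac ((fun q => ∑ i ∈ s, f i q) ∘ Y) θ = ∑ i ∈ s, jac (f i ∘ Y) θ by
    rw [h, Matrix.sum_mul, Matrix.sum_mul]
  ext β j
  have h1 : (fun q => ∑ i ∈ s, f i q) ∘ Y = fun ϑ => ∑ i ∈ s, (f i ∘ Y) ϑ := rfl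
  have h2 : ∀ i ∈ s, DifferentiableAt ℝ (f i ∘ Y) θ := fun i hi =>
    ((hY.contDiffOn_comp (hf i hi)).contDiffAt
      (hY.isOpen_source.mem_nhds hθ)).differentiableAt one_ne_zero
  rw [jac, Matrix.of_apply, h1, pd_sum s h2]
  simp [jac, Matrix.sum_apply]

theorem tangGrad_eq_zero {f : Euc (n + 1) → Euc (n + 1)} {q : Euc (n + 1)} (hq : q ∈ N)
    (hf : f =ᶠ[𝓝[N] q] 0) : tangGrad N ν f q = 0 := by
  ext β γ
  rw [tangGrad, Matrix.of_apply, hf.fderivWithin_eq (hf.self_of_nhdsWithin hq)]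
  simp

theorem tangGrad_congr {f f' : Euc (n + 1) → Euc (n + 1)} {q : Euc (n + 1)} (hq : q ∈ N)
    (hf : EqOn f f' N) : tangGrad N ν f q = tangGrad N ν f' q := by
  ext β γ
  rw [tangGrad, tangGrad, Matrix.of_apply, Matrix.of_apply, fderivWithin_congr hf (hf hq)]

theorem dotdotWith_sum {m : ℕ} {ι : Type*} (s : Finset ι) (K A : Matrix (Fin m) (Fin m) ℝ)
    (B : ι → Matrix (Fin m) (Fin m) ℝ) :
    dotdotWith K A (∑ i ∈ s, B i) = ∑ i ∈ s, dotdotWith K A (B i) := by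
  simp only [dotdotWith_eq_trace, Matrix.transpose_sum, Matrix.mul_sum, Matrix.trace_sum]

/-- A smooth partition of unity on a compact hypersurface subordinate to parametrizations. -/
theorem exists_param_partition {M : Set (Euc (n + 1))}
    {y : Euc (n + 1) → Euc (n + 1)} (hM : IsHypersurface ∞ M) (hy : IsEmbeddingOn 2 M y)
    (hc : IsCompact (y '' M)) :
    ∃ (ι : Type) (_ : Fintype ι) (Ω : ι → Set (Euc n)) (X : ι → Euc n → Euc (n + 1))
      (χ : ι → Euc (n + 1) → ℝ), (∀ i, IsLocalParam ∞ M (Ω i) (X i)) ∧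
      (∀ i, ContDiff ℝ 1 (χ i)) ∧ (∀ q ∈ y '' M, ∑ i, χ i q = 1) ∧
      ∀ i, tsupport (χ i) ∩ (y '' M) ⊆ (y ∘ X i) '' Ω i := by
  have h1 : ∀ q ∈ y '' M, ∃ (Ω : Set (Euc n)) (X : Euc n → Euc (n + 1)) (U : Set (Euc (n + 1))),
      IsLocalParam ∞ M Ω X ∧ IsOpen U ∧ (y ∘ X) '' Ω = (y '' M) ∩ U ∧ q ∈ U := by
    rintro _ ⟨p, hp, rfl⟩
    obtain ⟨Ω, X, hX, θ, hθ, rfl⟩ := hM p hp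
    obtain ⟨U, hUo, hU⟩ := (hy.isLocalParam_comp hX).isOpen_image
    exact ⟨Ω, X, U, hX, hUo, hU, (hU ▸ mem_image_of_mem (y ∘ X) hθ : y (X θ) ∈ y '' M ∩ U).2⟩
  choose Ω X U hX hUo hU hqU using h1
  obtain ⟨t, ht⟩ := hc.elim_finite_subcover (fun q : y '' M => U q q.2) (fun q => hUo q q.2)
    fun q hq => mem_iUnion.2 ⟨⟨q, hq⟩, hqU q hq⟩
  have ht' : y '' M ⊆ ⋃ q : t, U q.1 q.1.2 := fun q hq => by
    obtain ⟨p, hp, hq'⟩ := mem_iUnion₂.1 (ht hq)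
    exact mem_iUnion.2 ⟨⟨p, hp⟩, hq'⟩
  -- The partition is taken in the ambient space, so no manifold structure on the hypersurface is
  -- needed.
  obtain ⟨f, hf⟩ := SmoothPartitionOfUnity.exists_isSubordinate (modelWithCornersSelf ℝ (Euc (n + 1)))
    hc.isClosed (fun q : t => U q.1 q.1.2) (fun q => hUo _ q.1.2) ht'
  refine ⟨t, inferInstance, fun q => Ω q.1 q.1.2, fun q => X q.1 q.1.2, fun q => f q,
    fun q => hX _ q.1.2, fun q => ?_, fun q hq => ?_, fun q p hp => ?_⟩
  · exact (f q).contMDiff.contDiff.of_le (WithTop.coe_le_coe.2 (le_top : (1 : ℕ∞) ≤ ⊤))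
  · rw [← finsum_eq_sum_of_fintype]
    exact f.sum_eq_one hq
  · rw [hU]
    exact ⟨hp.2, hf q hp.1⟩

/-- A Laplacian in coordinates, cut off and transplanted to the hypersurface. -/
noncomputable def cutoffLaplacian (g : Euc n → Matrix (Fin n) (Fin n) ℝ) (Ω : Set (Euc n))
    (Y : Euc n → Euc (n + 1)) (χ : Euc (n + 1) → ℝ) (q : Euc (n + 1)) : Euc (n + 1) :=
  χ q • laplacian g Y (Function.invFunOn Y Ω q)

theorem continuousOn_cutoffLaplacian (hY : IsLocalParam 2 N Ω Y)
    {g : Euc n → Matrix (Fin n) (Fin n) ℝ} (hg : ∀ i j, ContDiffOn ℝ 1 (fun θ => g θ i j) Ω)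
    (hdet : ∀ θ ∈ Ω, 0 < (g θ).det) {χ : Euc (n + 1) → ℝ} (hχ : ContDiff ℝ 1 χ)
    (hsupp : tsupport χ ∩ N ⊆ Y '' Ω) : ContinuousOn (cutoffLaplacian g Ω Y χ) N := by
  intro q hq
  by_cases h : q ∈ tsupport χ
  · obtain ⟨θ, hθ, rfl⟩ := hsupp ⟨h, hq⟩
    refine (hY.continuousWithinAt_iff hθ).2 ?_
    have h1 : ContinuousOn (fun θ => χ (Y θ) • laplacian g Y θ) Ω :=
      (hχ.continuous.comp_continuousOn hY.contDiffOn.continuousOn).smul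
        (continuousOn_laplacian hY.isOpen_source hg hdet hY.contDiffOn)
    refine (h1.congr fun ϑ hϑ => ?_).continuousAt (hY.isOpen_source.mem_nhds hθ)
    rw [Function.comp_apply, cutoffLaplacian, hY.injOn.leftInvOn_invFunOn hϑ]
  · refine ContinuousWithinAt.congr_of_eventuallyEq
      (continuousWithinAt_const (b := (0 : Euc (n + 1)))) ?_ ?_
    · filter_upwards [mem_nhdsWithin_of_mem_nhds
        (notMem_tsupport_iff_eventuallyEq.1 h)] with p hp
      simp [cutoffLaplacian, show χ p = 0 from hp]
    · simp [cutoffLaplacian, image_eq_zero_of_notMem_tsupport h]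

/-- The formula on the patch is applied to `χ φ`; both summands vanish on the rest of `N`, so the
integral extends to all of `N`. -/
theorem integral_cutoffLaplacian_by_parts (hc : IsCompact N) (hν : IsUnitNormal N ν)
    (hN : IsHypersurface 1 N)
    (hY : IsLocalParam 2 N Ω Y) {g : Euc n → Matrix (Fin n) (Fin n) ℝ}
    (hsymm : ∀ θ, (g θ)ᵀ = g θ) (hg : ∀ i j, ContDiffOn ℝ 1 (fun θ => g θ i j) Ω)
    (hdet : ∀ θ ∈ Ω, 0 < (g θ).det)
    {K : Euc (n + 1) → Matrix (Fin (n + 1)) (Fin (n + 1)) ℝ} {w : Euc (n + 1) → ℝ}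
    (hKc : ContinuousOn K N) (hwc : ContinuousOn w N)
    (hK : ∀ θ ∈ Ω, K (Y θ) = jac Y θ * (g θ)⁻¹ * (jac Y θ)ᵀ +
      Matrix.vecMulVec (ν (Y θ)).ofLp (ν (Y θ)).ofLp)
    (hw : ∀ θ ∈ Ω, areaElement Y θ * w (Y θ) = √(g θ).det)
    {χ : Euc (n + 1) → ℝ} (hχ : ContDiff ℝ 1 χ)
    (hsupp : tsupport χ ∩ N ⊆ Y '' Ω)
    {φ : Euc (n + 1) → Euc (n + 1)} (hφ : ContDiffOn ℝ 1 φ N) :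
    ∫ q, (dotdotWith (K q) (tangGrad N ν (fun q => q) q) (tangGrad N ν (fun q => χ q • φ q) q) *
      w q + w q * ⟪cutoffLaplacian g Ω Y χ q, φ q⟫) ∂(surf N) = 0 := by
  have hχφ : ContDiffOn ℝ 1 (fun q => χ q • φ q) N := hχ.contDiffOn.smul hφ
  set L : Euc (n + 1) → Euc (n + 1) := fun q => laplacian g Y (Function.invFunOn Y Ω q) with hLdef
  have hL : ∀ θ ∈ Ω, L (Y θ) = laplacian g Y θ := fun θ hθ => by
    rw [hLdef]; simp only; rw [hY.injOn.leftInvOn_invFunOn hθ]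
  have hzero : ∀ q ∉ tsupport χ, ∀ᶠ p in 𝓝 q, χ p = 0 := fun q hq =>
    notMem_tsupport_iff_eventuallyEq.1 hq
  -- The part of the support lying on `N` is compact and contained in the image of the chart, so its
  -- preimage under the embedding is compact.
  have hCcomp : IsCompact (Ω ∩ Y ⁻¹' (tsupport χ ∩ N)) := by
    have h1 : IsCompact (tsupport χ ∩ N) := hc.inter_left (isClosed_tsupport χ)
    have h2 : Ω ∩ Y ⁻¹' (tsupport χ ∩ N) =
        Subtype.val '' ((Ω.domRestrict Y) ⁻¹' (tsupport χ ∩ N)) := by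
      ext θ; simp [Set.domRestrict]; tauto
    rw [h2]
    refine IsCompact.image ?_ continuous_subtype_val
    refine hY.isEmbedding.isInducing.isCompact_preimage' h1 ?_
    rwa [range_domRestrict]
  have key := integral_image_by_parts hν hN hY hsymm hg hdet hKc hwc hK hw hL hχφ hCcomp
    inter_subset_left fun θ hθ hθC => by
      have : Y θ ∉ tsupport χ := fun h => hθC ⟨hθ, h, hY.mapsTo hθ⟩
      simp [image_eq_zero_of_notMem_tsupport this]
  rw [← key, surf, setIntegral_eq_of_subset_of_forall_sdiff_eq_zero hc.measurableSet
    hY.mapsTo.image_subset]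
  · refine integral_congr_ae (Eventually.of_forall fun q => ?_)
    simp only [cutoffLaplacian, hLdef, real_inner_smul_left, real_inner_smul_right]
  · rintro q ⟨hq, hq'⟩
    have hqs : q ∉ tsupport χ := fun h => hq' (hsupp ⟨h, hq⟩)
    have h1 : (fun q => χ q • φ q) =ᶠ[𝓝[N] q] 0 := by
      filter_upwards [mem_nhdsWithin_of_mem_nhds (hzero q hqs)] with p hp
      simp [show χ p = 0 from hp]
    rw [tangGrad_eq_zero hq h1]
    simp [dotdotWith, cutoffLaplacian, image_eq_zero_of_notMem_tsupport hqs]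

end Globalization

/-! ### Integration by parts on the whole hypersurface -/

section GlobalLaplacians

variable {n : ℕ} {M : Set (Euc (n + 1))} {y ν : Euc (n + 1) → Euc (n + 1)}

/-- Since the cut-offs add up to `1` on the surface, the gradients of `χᵢ φ` add up to that of `φ`.
The coordinate metrics are tied together only through the common `K` and `w`, so coordinate
invariance of the Laplacian is never needed. -/
theorem integral_sum_cutoffLaplacian_by_parts (hM : IsHypersurface ∞ M) (hy : IsEmbeddingOn 2 M y)
    (hc : IsCompact (y '' M)) (hν : IsUnitNormal (y '' M) ν) {ι : Type} [Fintype ι]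
    {Ω : ι → Set (Euc n)} {X : ι → Euc n → Euc (n + 1)} {χ : ι → Euc (n + 1) → ℝ}
    (hX : ∀ i, IsLocalParam ∞ M (Ω i) (X i)) (hχ : ∀ i, ContDiff ℝ 1 (χ i))
    (hsum : ∀ q ∈ y '' M, ∑ i, χ i q = 1)
    (hsupp : ∀ i, tsupport (χ i) ∩ (y '' M) ⊆ (y ∘ X i) '' Ω i)
    {g : ι → Euc n → Matrix (Fin n) (Fin n) ℝ}
    (hsymm : ∀ i θ, (g i θ)ᵀ = g i θ)
    (hg : ∀ i a b, ContDiffOn ℝ 1 (fun θ => g i θ a b) (Ω i))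
    (hdet : ∀ i, ∀ θ ∈ Ω i, 0 < (g i θ).det)
    {K : Euc (n + 1) → Matrix (Fin (n + 1)) (Fin (n + 1)) ℝ} {w : Euc (n + 1) → ℝ}
    (hKc : ContinuousOn K (y '' M)) (hwc : ContinuousOn w (y '' M))
    (hK : ∀ i, ∀ θ ∈ Ω i, K (y (X i θ)) = jac (y ∘ X i) θ * (g i θ)⁻¹ * (jac (y ∘ X i) θ)ᵀ +
      Matrix.vecMulVec (ν (y (X i θ))).ofLp (ν (y (X i θ))).ofLp)
    (hw : ∀ i, ∀ θ ∈ Ω i, areaElement (y ∘ X i) θ * w (y (X i θ)) = √(g i θ).det)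
    {φ : Euc (n + 1) → Euc (n + 1)} (hφ : ContDiffOn ℝ 1 φ (y '' M)) :
    ∫ q, (dotdotWith (K q) (tangGrad (y '' M) ν (fun q => q) q) (tangGrad (y '' M) ν φ q) * w q +
      w q * ⟪∑ i, cutoffLaplacian (g i) (Ω i) (y ∘ X i) (χ i) q, φ q⟫) ∂(surf (y '' M)) = 0 := by
  have hN : IsHypersurface 1 (y '' M) := (hy.isHypersurface_image hM).mono (by norm_num)
  have hχφ : ∀ i, ContDiffOn ℝ 1 (fun q => χ i q • φ q) (y '' M) := fun i =>
    (hχ i).contDiffOn.smul hφ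
  have hpt : ∀ q ∈ y '' M, dotdotWith (K q) (tangGrad (y '' M) ν (fun q => q) q)
        (tangGrad (y '' M) ν φ q) * w q +
      w q * ⟪∑ i, cutoffLaplacian (g i) (Ω i) (y ∘ X i) (χ i) q, φ q⟫ =
      ∑ i, (dotdotWith (K q) (tangGrad (y '' M) ν (fun q => q) q)
        (tangGrad (y '' M) ν (fun q => χ i q • φ q) q) * w q +
        w q * ⟪cutoffLaplacian (g i) (Ω i) (y ∘ X i) (χ i) q, φ q⟫) := by
    intro q hq
    have h1 : tangGrad (y '' M) ν φ q = ∑ i, tangGrad (y '' M) ν (fun q => χ i q • φ q) q := by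
      rw [← tangGrad_sum hN hν Finset.univ (fun i _ => hχφ i) hq]
      refine tangGrad_congr hq fun p hp => ?_
      rw [← Finset.sum_smul, hsum p hp, one_smul]
    rw [h1, dotdotWith_sum, sum_inner, Finset.sum_mul, Finset.mul_sum, Finset.sum_add_distrib]
  have hgid : ContinuousOn (tangGrad (y '' M) ν fun q => q) (y '' M) :=
    continuousOn_tangGrad hN hν contDiffOn_id
  calc _ = ∫ q, ∑ i, (dotdotWith (K q) (tangGrad (y '' M) ν (fun q => q) q)
        (tangGrad (y '' M) ν (fun q => χ i q • φ q) q) * w q +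
        w q * ⟪cutoffLaplacian (g i) (Ω i) (y ∘ X i) (χ i) q, φ q⟫) ∂(surf (y '' M)) :=
        setIntegral_congr_fun hc.measurableSet hpt
    _ = 0 := by
        rw [integral_finsetSum _ fun i _ => ?_]
        · refine Finset.sum_eq_zero fun i _ => ?_
          exact integral_cutoffLaplacian_by_parts hc hν hN (hy.isLocalParam_comp (hX i)) (hsymm i)
            (hg i) (hdet i) hKc hwc (hK i) (hw i) (hχ i) (hsupp i) hφ
        · refine integrable_surf hN hc (ContinuousOn.add ?_ ?_)
          · exact (continuousOn_dotdotWith hKc hgid (continuousOn_tangGrad hN hν (hχφ i))).mul hwc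
          · exact hwc.mul ((continuousOn_cutoffLaplacian (hy.isLocalParam_comp (hX i)) (hg i)
              (hdet i) (hχ i) (hsupp i)).inner hφ.continuousOn)

theorem proj_add {m : ℕ} (ν v w : Euc m) : proj ν (v + w) = proj ν v + proj ν w := by
  simp only [proj, inner_add_right, add_smul]; abel

theorem proj_smul {m : ℕ} (ν : Euc m) (c : ℝ) (v : Euc m) : proj ν (c • v) = c • proj ν v := by
  simp only [proj, real_inner_smul_right, smul_sub, smul_smul]

theorem proj_sum {m : ℕ} {ι : Type*} (s : Finset ι) (ν : Euc m) (v : ι → Euc m) :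
    proj ν (∑ i ∈ s, v i) = ∑ i ∈ s, proj ν (v i) := by
  simp only [proj, inner_sum, Finset.sum_smul, Finset.sum_sub_distrib]

/-- The Laplacians of the metrics induced by the embedding and by the ambient space, as continuous
fields on the hypersurface that satisfy the integration by parts formulas. -/
theorem exists_laplacian_fields (hM : IsHypersurface ∞ M) (hy : IsEmbeddingOn 2 M y)
    (hc : IsCompact (y '' M)) (hν : IsUnitNormal (y '' M) ν) {a : Euc (n + 1) → Euc (n + 1)}
    (ha : ∀ (Ω : Set (Euc n)) (X : Euc n → Euc (n + 1)), IsLocalParam ∞ M Ω X → ∀ θ ∈ Ω,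
      a (y (X θ)) = laplacian (inducedMetric (y ∘ X)) (y ∘ X) θ + volumeRatio X (y ∘ X) θ •
        proj (ν (y (X θ))) (laplacian (inducedMetric X) (y ∘ X) θ)) :
    ∃ Lg Lh : Euc (n + 1) → Euc (n + 1), ContinuousOn Lg (y '' M) ∧ ContinuousOn Lh (y '' M) ∧
      (∀ q ∈ y '' M, a q = Lg q + √(HMat M y ν q).det • proj (ν q) (Lh q)) ∧
      ∀ φ : Euc (n + 1) → Euc (n + 1), ContDiffOn ℝ 1 φ (y '' M) →
        ∫ q, (dotdotWith 1 (tangGrad (y '' M) ν (fun q => q) q) (tangGrad (y '' M) ν φ q) * 1 +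
          1 * ⟪Lg q, φ q⟫) ∂(surf (y '' M)) = 0 ∧
        ∫ q, (dotdotWith (HMat M y ν q)⁻¹ (tangGrad (y '' M) ν (fun q => q) q)
          (tangGrad (y '' M) ν φ q) * √(HMat M y ν q).det +
          √(HMat M y ν q).det * ⟪Lh q, φ q⟫) ∂(surf (y '' M)) = 0 := by
  obtain ⟨ι, _, Ω, X, χ, hX, hχ, hsum, hsupp⟩ := exists_param_partition hM hy hc
  have hY := fun i => hy.isLocalParam_comp (hX i)
  have hX2 : ∀ i, ContDiffOn ℝ 2 (X i) (Ω i) := fun i =>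
    (hX i).contDiffOn.of_le (WithTop.coe_le_coe.2 (le_top : (2 : ℕ∞) ≤ ⊤))
  have hgg := fun i => contDiffOn_inducedMetric (hY i).isOpen_source (hY i).contDiffOn
  have hgh := fun i => contDiffOn_inducedMetric (hX i).isOpen_source (hX2 i)
  have hdg : ∀ i, ∀ θ ∈ Ω i, 0 < (inducedMetric (y ∘ X i) θ).det := fun i θ hθ =>
    det_inducedMetric_pos ((hY i).immersion θ hθ)
  have hdh : ∀ i, ∀ θ ∈ Ω i, 0 < (inducedMetric (X i) θ).det := fun i θ hθ =>
    det_inducedMetric_pos ((hX i).immersion θ hθ)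
  have hHc := continuousOn_hMat hM hy hν
  have hρc : ContinuousOn (fun q => √(HMat M y ν q).det) (y '' M) :=
    ((Continuous.matrix_det continuous_id).comp_continuousOn hHc).sqrt
  have hHic : ContinuousOn (fun q => (HMat M y ν q)⁻¹) (y '' M) :=
    continuousOn_inv_matrix hHc fun q hq => (det_hMat_pos hM hy hν hq).ne'
  refine ⟨fun q => ∑ i, cutoffLaplacian (inducedMetric (y ∘ X i)) (Ω i) (y ∘ X i) (χ i) q,
    fun q => ∑ i, cutoffLaplacian (inducedMetric (X i)) (Ω i) (y ∘ X i) (χ i) q,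
    continuousOn_finsetSum _ fun i _ =>
      continuousOn_cutoffLaplacian (hY i) (hgg i) (hdg i) (hχ i) (hsupp i),
    continuousOn_finsetSum _ fun i _ =>
      continuousOn_cutoffLaplacian (hY i) (hgh i) (hdh i) (hχ i) (hsupp i),
    fun q hq => ?_, fun φ hφ => ⟨?_, ?_⟩⟩
  -- The equation holds in every chart with the same left side `a`; weighting it with `χ i` and
  -- summing gives the global one.
  · have hterm : ∀ i, χ i q • a q =
        cutoffLaplacian (inducedMetric (y ∘ X i)) (Ω i) (y ∘ X i) (χ i) q +
        √(HMat M y ν q).det • proj (ν q)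
          (cutoffLaplacian (inducedMetric (X i)) (Ω i) (y ∘ X i) (χ i) q) := by
      intro i
      by_cases h : q ∈ tsupport (χ i)
      · obtain ⟨θ, hθ, rfl⟩ := hsupp i ⟨h, hq⟩
        have h1 := (hY i).injOn.leftInvOn_invFunOn hθ
        simp only [cutoffLaplacian, h1, proj_smul]
        simp only [Function.comp_apply]
        rw [ha _ _ (hX i) θ hθ, sqrt_det_hMat hM hy hν (hX i) hθ, smul_add, smul_comm (χ i _)]
      · simp [cutoffLaplacian, image_eq_zero_of_notMem_tsupport h, proj]
    calc a q = ∑ i, χ i q • a q := by rw [← Finset.sum_smul, hsum q hq, one_smul]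
      _ = _ := by
        rw [proj_sum, Finset.smul_sum, ← Finset.sum_add_distrib]
        exact Finset.sum_congr rfl fun i _ => hterm i
  -- Metric of the embedding: `K = 1` by completeness, weight `1`.
  · refine integral_sum_cutoffLaplacian_by_parts hM hy hc hν hX hχ hsum hsupp
      (fun i θ => inducedMetric_transpose _ _) hgg hdg continuousOn_const continuousOn_const
      (fun i θ hθ => ?_) (fun i θ hθ => mul_one _) hφ
    rw [inducedMetric_eq]
    exact (hν.tangent_add_normal ((hY i).mono (by norm_num)) hθ).symm
  -- Metric of the reference surface: `K = Ĥ⁻¹` and weight `√det Ĥ`, which converts `√det g` into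
  -- `√det h`.
  · refine integral_sum_cutoffLaplacian_by_parts hM hy hc hν hX hχ hsum hsupp
      (fun i θ => inducedMetric_transpose _ _) hgh hdh hHic hρc
      (fun i θ hθ => inv_hMat_param hM hy hν (hX i) hθ) (fun i θ hθ => ?_) hφ
    rw [sqrt_det_hMat hM hy hν (hX i) hθ, volumeRatio, areaElement]
    exact mul_div_cancel₀ _ (Real.sqrt_pos.2 (hdg i θ hθ)).ne'

end GlobalLaplacians

/-! ### Convergence in `L²` with continuous coefficients -/

section SquareIntegrable

variable {n : ℕ} {N : Set (Euc (n + 1))} {ν : Euc (n + 1) → Euc (n + 1)}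

/-- Convergence in `L²` of square integrable functions to a square integrable function. -/
structure L2Tendsto {Z : Type*} [MeasurableSpace Z] (μ : Measure Z) (F : ℕ → Z → ℝ)
    (f : Z → ℝ) : Prop where
  memLp : MemLp f 2 μ
  memLp_seq : ∀ k, MemLp (F k) 2 μ
  tendsto : Tendsto (fun k => eLpNorm (fun z => F k z - f z) 2 μ) atTop (𝓝 0)

namespace L2Tendsto

variable {Z : Type*} [MeasurableSpace Z] {μ : Measure Z} {F G : ℕ → Z → ℝ} {f g : Z → ℝ}

theorem zero : L2Tendsto μ (fun _ _ => 0) fun _ => 0 :=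
  ⟨MemLp.zero, fun _ => MemLp.zero, by simp⟩

theorem add (hF : L2Tendsto μ F f) (hG : L2Tendsto μ G g) :
    L2Tendsto μ (fun k z => F k z + G k z) fun z => f z + g z := by
  refine ⟨hF.1.add hG.1, fun k => (hF.2 k).add (hG.2 k), ?_⟩
  have h := hF.3.add hG.3
  rw [add_zero] at h
  refine tendsto_of_tendsto_of_tendsto_of_le_of_le tendsto_const_nhds h (fun _ => zero_le)
    fun k => ?_
  have := eLpNorm_add_le (p := 2) ((hF.2 k).sub hF.1).aestronglyMeasurable
    ((hG.2 k).sub hG.1).aestronglyMeasurable (by norm_num)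
  refine le_trans (le_of_eq ?_) this
  congr 1
  ext z
  simp only [Pi.add_apply, Pi.sub_apply]
  ring

theorem sum {ι : Type*} (s : Finset ι) {F : ι → ℕ → Z → ℝ} {f : ι → Z → ℝ}
    (h : ∀ i ∈ s, L2Tendsto μ (F i) (f i)) :
    L2Tendsto μ (fun k z => ∑ i ∈ s, F i k z) fun z => ∑ i ∈ s, f i z := by
  classical
  induction s using Finset.induction_on with
  | empty => simpa using zero
  | insert a s ha ih =>
    simp only [Finset.sum_insert ha]
    exact (h a (Finset.mem_insert_self a s)).add
      (ih fun i hi => h i (Finset.mem_insert_of_mem hi))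

theorem mul_bounded (hF : L2Tendsto μ F f) {c : Z → ℝ} (hc : AEStronglyMeasurable c μ) {C : ℝ}
    (hC : ∀ᵐ z ∂μ, ‖c z‖ ≤ C) : L2Tendsto μ (fun k z => c z * F k z) fun z => c z * f z := by
  have hb : ∀ h : Z → ℝ, ∀ᵐ z ∂μ, ‖c z * h z‖ ≤ C * ‖h z‖ := fun h => by
    filter_upwards [hC] with z hz
    rw [norm_mul]
    gcongr
  refine ⟨hF.1.of_le_mul (hc.mul hF.1.1) (hb f),
    fun k => (hF.2 k).of_le_mul (hc.mul (hF.2 k).1) (hb _), ?_⟩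
  have h := ENNReal.Tendsto.const_mul (a := ENNReal.ofReal C) hF.3 (Or.inr ENNReal.ofReal_ne_top)
  rw [mul_zero] at h
  refine tendsto_of_tendsto_of_tendsto_of_le_of_le tendsto_const_nhds h (fun _ => zero_le)
    fun k => ?_
  refine eLpNorm_le_mul_eLpNorm_of_ae_le_mul ?_ 2
  filter_upwards [hb fun z => F k z - f z] with z hz
  rwa [mul_sub] at hz

theorem congr (hF : L2Tendsto μ F f) (h : ∀ k, G k =ᵐ[μ] F k) (h' : g =ᵐ[μ] f) :
    L2Tendsto μ G g := by
  refine ⟨(memLp_congr_ae h').2 hF.1, fun k => (memLp_congr_ae (h k)).2 (hF.2 k), ?_⟩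
  refine hF.3.congr fun k => eLpNorm_congr_ae ?_
  filter_upwards [h k, h'] with z hz hz'
  rw [hz, hz']

/-- On a finite measure space convergence in `L²` implies convergence in `L¹`. -/
theorem tendsto_integral [IsFiniteMeasure μ] (hF : L2Tendsto μ F f) :
    Tendsto (fun k => ∫ z, F k z ∂μ) atTop (𝓝 (∫ z, f z ∂μ)) := by
  refine tendsto_integral_of_L1' f hF.1.1
    (Eventually.of_forall fun k => (hF.2 k).integrable one_le_two) ?_
  have h := ENNReal.Tendsto.mul_const (b := μ Set.univ ^ (1 / (1 : ENNReal).toReal - 1 / (2 : ENNReal).toReal))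
    hF.3 (Or.inr (ENNReal.rpow_ne_top_of_nonneg (by norm_num) (measure_ne_top _ _)))
  rw [zero_mul] at h
  refine tendsto_of_tendsto_of_tendsto_of_le_of_le tendsto_const_nhds h (fun _ => zero_le)
    fun k => ?_
  exact eLpNorm_le_eLpNorm_mul_rpow_measure_univ one_le_two ((hF.2 k).sub hF.1).aestronglyMeasurable

end L2Tendsto

theorem exists_bound_surf (hc : IsCompact N) {c : Euc (n + 1) → ℝ} (hcc : ContinuousOn c N) :
    ∃ C, ∀ᵐ q ∂(surf N), ‖c q‖ ≤ C := by
  obtain ⟨C, hC⟩ := hc.exists_bound_of_continuousOn hcc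
  exact ⟨C, (ae_restrict_iff' hc.measurableSet).2 (Eventually.of_forall hC)⟩

theorem L2Tendsto.continuousOn_mul {F : ℕ → Euc (n + 1) → ℝ} {f : Euc (n + 1) → ℝ}
    (hF : L2Tendsto (surf N) F f) (hc : IsCompact N) {c : Euc (n + 1) → ℝ}
    (hcc : ContinuousOn c N) : L2Tendsto (surf N) (fun k z => c z * F k z) fun z => c z * f z := by
  obtain ⟨C, hC⟩ := exists_bound_surf hc hcc
  exact hF.mul_bounded (hcc.aestronglyMeasurable hc.measurableSet) hC

theorem memLp_surf {W : Type*} [NormedAddCommGroup W] (hN : IsHypersurface 1 N) (hc : IsCompact N)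
    {f : Euc (n + 1) → W} (hf : ContinuousOn f N) : MemLp f 2 (surf N) := by
  have := isFiniteMeasure_surf hN hc
  obtain ⟨C, hC⟩ := hc.exists_bound_of_continuousOn hf
  exact MemLp.of_bound
    (hf.aestronglyMeasurable_of_isCompact hc hc.measurableSet) C
    ((ae_restrict_iff' hc.measurableSet).2 (Eventually.of_forall hC))

end SquareIntegrable

/-! ### Extension to Sobolev test fields -/

section Sobolev

variable {n : ℕ} {N : Set (Euc (n + 1))} {ν η : Euc (n + 1) → Euc (n + 1)}
  {G : Euc (n + 1) → Matrix (Fin (n + 1)) (Fin (n + 1)) ℝ}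

/-- Square integrability of the approximants and of their gradients is automatic: both are
continuous on a compact hypersurface of finite area. -/
theorem HasSobolevGrad.exists_l2Tendsto (hN : IsHypersurface 1 N) (hc : IsCompact N)
    (hν : IsUnitNormal N ν) (h : HasSobolevGrad N ν η G) :
    ∃ φ : ℕ → Euc (n + 1) → Euc (n + 1), (∀ k, ContDiffOn ℝ 1 (φ k) N) ∧
      Tendsto (fun k => eLpNorm (fun q => φ k q - η q) 2 (surf N)) atTop (𝓝 0) ∧
      (∀ β, L2Tendsto (surf N) (fun k q => φ k q β) fun q => η q β) ∧
      ∀ β γ, L2Tendsto (surf N) (fun k q => tangGrad N ν (φ k) q β γ) fun q => G q β γ := by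
  obtain ⟨hη, hG, φ, hφ, hφη, hφG⟩ := h
  refine ⟨φ, hφ, hφη, fun β => ⟨?_, fun k => ?_, ?_⟩, fun β γ => ⟨hG β γ, fun k => ?_, hφG β γ⟩⟩
  · exact (EuclideanSpace.proj β : Euc (n + 1) →L[ℝ] ℝ).comp_memLp' hη
  · exact memLp_surf hN hc
      ((EuclideanSpace.proj β : Euc (n + 1) →L[ℝ] ℝ).continuous.comp_continuousOn
        (hφ k).continuousOn)
  · refine tendsto_of_tendsto_of_tendsto_of_le_of_le tendsto_const_nhds hφη (fun _ => zero_le)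
      fun k => eLpNorm_mono fun q => ?_
    exact PiLp.norm_apply_le (φ k q - η q) β
  · exact memLp_surf hN hc
      (continuousOn_pi.1 (continuousOn_pi.1 (continuousOn_tangGrad hN hν (hφ k)) β) γ)

theorem dotdotWith_mul_eq_sum {m : ℕ} (K A B : Matrix (Fin m) (Fin m) ℝ) (w : ℝ) :
    dotdotWith K A B * w = ∑ γ, ∑ κ, ∑ β, (K γ κ * A β γ * w) * B β κ := by
  simp only [dotdotWith, Finset.sum_mul]
  refine Finset.sum_congr rfl fun γ _ => Finset.sum_congr rfl fun κ _ =>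
    Finset.sum_congr rfl fun β _ => ?_
  ring

theorem l2Tendsto_dotdotWith (hc : IsCompact N)
    {K A : Euc (n + 1) → Matrix (Fin (n + 1)) (Fin (n + 1)) ℝ} {w : Euc (n + 1) → ℝ}
    (hK : ContinuousOn K N) (hA : ContinuousOn A N) (hw : ContinuousOn w N)
    {B : ℕ → Euc (n + 1) → Matrix (Fin (n + 1)) (Fin (n + 1)) ℝ}
    (hB : ∀ β γ, L2Tendsto (surf N) (fun k q => B k q β γ) fun q => G q β γ) :
    L2Tendsto (surf N) (fun k q => dotdotWith (K q) (A q) (B k q) * w q)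
      fun q => dotdotWith (K q) (A q) (G q) * w q := by
  simp only [dotdotWith_mul_eq_sum]
  refine L2Tendsto.sum _ fun γ _ => L2Tendsto.sum _ fun κ _ => L2Tendsto.sum _ fun β _ => ?_
  exact (hB β κ).continuousOn_mul hc
    (((continuousOn_pi.1 (continuousOn_pi.1 hK γ) κ).mul
      (continuousOn_pi.1 (continuousOn_pi.1 hA β) γ)).mul hw)

theorem l2Tendsto_inner (hc : IsCompact N) {V : Euc (n + 1) → Euc (n + 1)}
    (hV : ContinuousOn V N) {φ : ℕ → Euc (n + 1) → Euc (n + 1)}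
    (hφ : ∀ β, L2Tendsto (surf N) (fun k q => φ k q β) fun q => η q β) :
    L2Tendsto (surf N) (fun k q => ⟪V q, φ k q⟫) fun q => ⟪V q, η q⟫ := by
  have : ∀ v w : Euc (n + 1), ⟪v, w⟫ = ∑ β, v β * w β := fun v w => by
    simp [PiLp.inner_apply, mul_comm]
  simp only [this]
  refine L2Tendsto.sum _ fun β _ => (hφ β).continuousOn_mul hc ?_
  exact (EuclideanSpace.proj β : Euc (n + 1) →L[ℝ] ℝ).continuous.comp_continuousOn hV

/-- Integration by parts extends from `C¹` to Sobolev test functions. -/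
theorem HasSobolevGrad.integral_by_parts (hN : IsHypersurface 1 N) (hc : IsCompact N)
    (hν : IsUnitNormal N ν) (h : HasSobolevGrad N ν η G)
    {K : Euc (n + 1) → Matrix (Fin (n + 1)) (Fin (n + 1)) ℝ} {w : Euc (n + 1) → ℝ}
    {L : Euc (n + 1) → Euc (n + 1)} (hK : ContinuousOn K N) (hw : ContinuousOn w N)
    (hL : ContinuousOn L N)
    (hparts : ∀ φ : Euc (n + 1) → Euc (n + 1), ContDiffOn ℝ 1 φ N →
      ∫ q, (dotdotWith (K q) (tangGrad N ν (fun q => q) q) (tangGrad N ν φ q) * w q +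
        w q * ⟪L q, φ q⟫) ∂(surf N) = 0) :
    Integrable (fun q => dotdotWith (K q) (tangGrad N ν (fun q => q) q) (G q) * w q) (surf N) ∧
    Integrable (fun q => w q * ⟪L q, η q⟫) (surf N) ∧
    ∫ q, dotdotWith (K q) (tangGrad N ν (fun q => q) q) (G q) * w q ∂(surf N) +
      ∫ q, w q * ⟪L q, η q⟫ ∂(surf N) = 0 := by
  have := isFiniteMeasure_surf hN hc
  obtain ⟨φ, hφ, -, hφη, hφG⟩ := h.exists_l2Tendsto hN hc hν
  have hgid : ContinuousOn (tangGrad N ν fun q => q) N :=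
    continuousOn_tangGrad hN hν contDiffOn_id
  have h1 := l2Tendsto_dotdotWith hc hK hgid hw hφG
  have h2 := (l2Tendsto_inner hc hL hφη).continuousOn_mul hc hw
  have i1 := h1.memLp.integrable one_le_two
  have i2 := h2.memLp.integrable one_le_two
  refine ⟨i1, i2, ?_⟩
  rw [← integral_add i1 i2]
  -- The integrals along the approximating sequence all vanish, hence so does their limit.
  -- Uniqueness of the Sobolev gradient plays no role.
  refine tendsto_nhds_unique (h1.add h2).tendsto_integral ?_
  simp only [hparts _ (hφ _)]
  exact tendsto_const_nhds

end Sobolev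

/-! ### The tangential part of a Sobolev field -/

section TangentialPart

variable {n : ℕ} {N : Set (Euc (n + 1))} {ν η : Euc (n + 1) → Euc (n + 1)}
  {G : Euc (n + 1) → Matrix (Fin (n + 1)) (Fin (n + 1)) ℝ}

/-- The columns of `ν ⊗ ν`. -/
def normalColumn (ν : Euc (n + 1) → Euc (n + 1)) (γ : Fin (n + 1)) (q : Euc (n + 1)) :
    Euc (n + 1) :=
  ν q γ • ν q

theorem contDiffOn_normalColumn (hN : IsHypersurface 2 N) (hν : IsUnitNormal N ν)
    (γ : Fin (n + 1)) : ContDiffOn ℝ 1 (normalColumn ν γ) N :=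
  contDiffOn_euclidean.2 fun β => contDiffOn_normal_mul hN hν γ β

/-- This writes `P` through `ν ⊗ ν` alone, which is `C¹` on a `C²` hypersurface although `ν` itself
may fail to be continuous. -/
theorem proj_eq_sub_sum (ν : Euc (n + 1) → Euc (n + 1)) (v : Euc (n + 1)) (q : Euc (n + 1)) :
    proj (ν q) v = v - ∑ γ, v γ • normalColumn ν γ q := by
  simp only [proj, normalColumn, PiLp.inner_apply, RCLike.inner_apply, conj_trivial, smul_smul,
    ← Finset.sum_smul]

theorem contDiffOn_proj (hN : IsHypersurface 2 N) (hν : IsUnitNormal N ν)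
    {φ : Euc (n + 1) → Euc (n + 1)} (hφ : ContDiffOn ℝ 1 φ N) :
    ContDiffOn ℝ 1 (fun q => proj (ν q) (φ q)) N := by
  simp only [proj_eq_sub_sum]
  exact hφ.sub (ContDiffOn.sum fun γ _ =>
    (contDiffOn_euclidean.1 hφ γ).smul (contDiffOn_normalColumn hN hν γ))

theorem continuousOn_proj (hN : IsHypersurface 2 N) (hν : IsUnitNormal N ν)
    {V : Euc (n + 1) → Euc (n + 1)} (hV : ContinuousOn V N) :
    ContinuousOn (fun q => proj (ν q) (V q)) N := by
  simp only [proj_eq_sub_sum]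
  exact hV.sub (continuousOn_finsetSum _ fun γ _ =>
    ((EuclideanSpace.proj γ : Euc (n + 1) →L[ℝ] ℝ).continuous.comp_continuousOn hV).smul
      (contDiffOn_normalColumn hN hν γ).continuousOn)

theorem jac_apply {m : ℕ} {F : Euc n → Euc m} {θ : Euc n} (hF : DifferentiableAt ℝ F θ)
    (β : Fin m) (j : Fin n) : jac F θ β j = pd j (fun ϑ => F ϑ β) θ := by
  have := (EuclideanSpace.proj β : Euc m →L[ℝ] ℝ).hasFDerivAt.comp θ hF.hasFDerivAt
  rw [jac, Matrix.of_apply, pd, pd]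
  exact (congrArg (fun T : Euc n →L[ℝ] ℝ => T (EuclideanSpace.single j 1)) this.fderiv).symm

/-- The tangential gradient of the tangential part of a field. -/
theorem tangGrad_proj (hN : IsHypersurface 2 N) (hν : IsUnitNormal N ν)
    {φ : Euc (n + 1) → Euc (n + 1)} (hφ : ContDiffOn ℝ 1 φ N) {q : Euc (n + 1)} (hq : q ∈ N)
    (β κ : Fin (n + 1)) :
    tangGrad N ν (fun q => proj (ν q) (φ q)) q β κ = tangGrad N ν φ q β κ -
      ∑ γ, (normalColumn ν γ q β * tangGrad N ν φ q γ κ +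
        tangGrad N ν (normalColumn ν γ) q β κ * φ q γ) := by
  obtain ⟨Ω, Y, hY, θ, hθ, rfl⟩ := (hN.mono (k' := 1) (by norm_num)) q hq
  have hb := contDiffOn_normalColumn hN hν
  have hPφ := contDiffOn_proj hN hν hφ
  have hdiff : ∀ {f : Euc (n + 1) → Euc (n + 1)}, ContDiffOn ℝ 1 f N →
      DifferentiableAt ℝ (f ∘ Y) θ := fun hf =>
    ((hY.contDiffOn_comp hf).contDiffAt (hY.isOpen_source.mem_nhds hθ)).differentiableAt
      one_ne_zero
  have hdiff' : ∀ {f : Euc (n + 1) → Euc (n + 1)}, ContDiffOn ℝ 1 f N → ∀ γ,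
      DifferentiableAt ℝ (fun ϑ => f (Y ϑ) γ) θ := fun hf γ =>
    (EuclideanSpace.proj γ : Euc (n + 1) →L[ℝ] ℝ).differentiableAt.comp θ (hdiff hf)
  have hd : ∀ {f : Euc (n + 1) → Euc (n + 1)}, ContDiffOn ℝ 1 f N →
      DifferentiableWithinAt ℝ f N (Y θ) := fun hf => hf.differentiableOn one_ne_zero _ hq
  have hjac : ∀ j, jac ((fun q => proj (ν q) (φ q)) ∘ Y) θ β j = jac (φ ∘ Y) θ β j -
      ∑ γ, (normalColumn ν γ (Y θ) β * jac (φ ∘ Y) θ γ j +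
        jac (normalColumn ν γ ∘ Y) θ β j * φ (Y θ) γ) := by
    intro j
    rw [jac_apply (hdiff hPφ), jac_apply (hdiff hφ)]
    have e : (fun ϑ => ((fun q => proj (ν q) (φ q)) ∘ Y) ϑ β) =
        fun ϑ => φ (Y ϑ) β - ∑ γ, φ (Y ϑ) γ * normalColumn ν γ (Y ϑ) β := by
      ext ϑ
      simp [proj_eq_sub_sum]
    have hterm : ∀ γ ∈ Finset.univ, DifferentiableAt ℝ
        (fun ϑ => φ (Y ϑ) γ * normalColumn ν γ (Y ϑ) β) θ := fun γ _ =>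
      (hdiff' hφ γ).fun_mul (hdiff' (hb γ) β)
    have hsub : pd j (fun ϑ => φ (Y ϑ) β - ∑ γ, φ (Y ϑ) γ * normalColumn ν γ (Y ϑ) β) θ =
        pd j (fun ϑ => φ (Y ϑ) β) θ -
          pd j (fun ϑ => ∑ γ, φ (Y ϑ) γ * normalColumn ν γ (Y ϑ) β) θ := by
      simp only [pd]
      rw [fderiv_fun_sub (hdiff' hφ β) (DifferentiableAt.fun_sum hterm)]
      rfl
    rw [e, hsub, pd_sum _ hterm]
    congr 1
    refine Finset.sum_congr rfl fun γ _ => ?_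
    rw [pd_mul (hdiff' hφ γ) (hdiff' (hb γ) β), jac_apply (hdiff hφ), jac_apply (hdiff (hb γ))]
    simp only [Function.comp_apply]
    ring
  simp only [tangGrad_param hν hY hθ (hd hPφ), tangGrad_param hν hY hθ (hd hφ),
    tangGrad_param hν hY hθ (hd (hb _)), Matrix.mul_assoc]
  set R := ((jac Y θ)ᵀ * jac Y θ)⁻¹ * (jac Y θ)ᵀ
  simp only [Matrix.mul_apply (N := R), hjac, sub_mul, Finset.sum_sub_distrib, Finset.sum_mul,
    Finset.mul_sum]
  congr 1
  rw [Finset.sum_comm]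
  refine Finset.sum_congr rfl fun γ _ => ?_
  rw [← Finset.sum_add_distrib]
  refine Finset.sum_congr rfl fun j _ => ?_
  ring

theorem norm_proj_le {m : ℕ} {ν : Euc m} (hν : ‖ν‖ = 1) (v : Euc m) : ‖proj ν v‖ ≤ ‖v‖ := by
  refine abs_le_of_sq_le_sq' ?_ (norm_nonneg v) |>.2
  have h1 : ⟪ν, ν⟫ = 1 := by rw [real_inner_self_eq_norm_sq, hν, one_pow]
  rw [← real_inner_self_eq_norm_sq, ← real_inner_self_eq_norm_sq]
  simp only [proj, inner_sub_left, inner_sub_right, real_inner_smul_left, real_inner_smul_right,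
    h1, real_inner_comm ν v]
  nlinarith [sq_nonneg ⟪v, ν⟫]

/-- The tangential part of a Sobolev field is a Sobolev field. -/
theorem HasSobolevGrad.exists_proj (hN : IsHypersurface 2 N) (hc : IsCompact N)
    (hν : IsUnitNormal N ν) (h : HasSobolevGrad N ν η G) :
    ∃ G', HasSobolevGrad N ν (fun q => proj (ν q) (η q)) G' := by
  have hN1 : IsHypersurface 1 N := hN.mono (by norm_num)
  obtain ⟨φ, hφ, hφη, hcomp, hgrad⟩ := h.exists_l2Tendsto hN1 hc hν
  have hb := contDiffOn_normalColumn hN hν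
  have hbc : ∀ γ β, ContinuousOn (fun q => normalColumn ν γ q β) N := fun γ β =>
    (contDiffOn_euclidean.1 (hb γ) β).continuousOn
  have hbg : ∀ γ β κ, ContinuousOn (fun q => tangGrad N ν (normalColumn ν γ) q β κ) N :=
    fun γ β κ => continuousOn_pi.1 (continuousOn_pi.1 (continuousOn_tangGrad hN1 hν (hb γ)) β) κ
  have hmem : ∀ᵐ q ∂(surf N), q ∈ N := ae_restrict_mem hc.measurableSet
  have hle : ∀ v : Euc (n + 1) → Euc (n + 1),
      ∀ᵐ q ∂(surf N), ‖proj (ν q) (v q)‖ ≤ ‖v q‖ := fun v => by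
    filter_upwards [hmem] with q hq using norm_proj_le (hν.1 q hq) _
  -- The product rule expresses the gradient of `P φₖ` linearly in `φₖ` and its gradient with
  -- continuous coefficients; the `L²` limit is the candidate gradient of `P η`.
  have hlim : ∀ β κ, L2Tendsto (surf N)
      (fun k q => tangGrad N ν (fun q => proj (ν q) (φ k q)) q β κ)
      fun q => G q β κ + ∑ γ, (-normalColumn ν γ q β * G q γ κ +
        -tangGrad N ν (normalColumn ν γ) q β κ * η q γ) := fun β κ => by
    refine ((hgrad β κ).add (L2Tendsto.sum Finset.univ fun γ _ =>
      ((hgrad γ κ).continuousOn_mul hc (hbc γ β).neg).add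
        ((hcomp γ).continuousOn_mul hc (hbg γ β κ).neg))).congr (fun k => ?_) (ae_eq_refl _)
    filter_upwards [hmem] with q hq
    rw [tangGrad_proj hN hν (hφ k) hq, sub_eq_add_neg, ← Finset.sum_neg_distrib]
    congr 1
    refine Finset.sum_congr rfl fun γ _ => ?_
    simp only [Pi.neg_apply]
    ring
  refine ⟨fun q => Matrix.of fun β κ => G q β κ + ∑ γ, (-normalColumn ν γ q β * G q γ κ +
        -tangGrad N ν (normalColumn ν γ) q β κ * η q γ), ?_, fun β κ => (hlim β κ).memLp,
    fun k q => proj (ν q) (φ k q), fun k => contDiffOn_proj hN hν (hφ k), ?_,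
    fun β κ => (hlim β κ).tendsto⟩
  · refine h.1.of_le ?_ (hle η)
    simp only [proj_eq_sub_sum]
    refine h.1.1.sub (Finset.aestronglyMeasurable_fun_sum _ fun γ _ => ?_)
    exact (hcomp γ).memLp.1.smul
      ((hb γ).continuousOn.aestronglyMeasurable hc.measurableSet)
  · refine tendsto_of_tendsto_of_tendsto_of_le_of_le tendsto_const_nhds hφη (fun _ => zero_le)
      fun k => eLpNorm_mono_ae ?_
    filter_upwards [hle fun q => φ k q - η q] with q hq
    refine le_trans (le_of_eq ?_) hq
    rw [sub_eq_add_neg (φ k q), ← neg_one_smul ℝ (η q), proj_add, proj_smul, neg_one_smul,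
      ← sub_eq_add_neg]

theorem inner_proj_left {m : ℕ} (ν v w : Euc m) : ⟪proj ν v, w⟫ = ⟪v, proj ν w⟫ := by
  simp only [proj, inner_sub_left, inner_sub_right, real_inner_smul_left, real_inner_smul_right,
    real_inner_comm ν v]
  ring

end TangentialPart

end HypersurfaceFlow

/-! ### The weak formulation of the flow -/

theorem mainTheorem7 {n : ℕ} (α : ℝ) (hα : 0 < α)
    (M : Set (Euc (n + 1))) (hM : IsHypersurface ∞ M) (hMcompact : IsCompact M)
    (hMconn : IsConnected M) (T : ℝ)
    (x : ℝ → Euc (n + 1) → Euc (n + 1)) (ν : ℝ → Euc (n + 1) → Euc (n + 1))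
    (hflow : SolvesVariantFlow α M T x ν) (t : ℝ) (ht : t ∈ Ico 0 T) :
    let Γ : Set (Euc (n + 1)) := x t '' M
    let H : Euc (n + 1) → Matrix (Fin (n + 1)) (Fin (n + 1)) ℝ := HMat M (x t) (ν t)
    let ρ : Euc (n + 1) → ℝ := fun q => √(H q).det
    let u : ℝ → Euc (n + 1) → Euc (n + 1) := fun _ q => q
    let ut : Euc (n + 1) → Euc (n + 1) := materialDeriv M T x u t
    let gradu : Euc (n + 1) → Matrix (Fin (n + 1)) (Fin (n + 1)) ℝ := tangGrad Γ (ν t) (u t)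
    -- the weight `ρ = √det Ĥ` is the density ratio `√det h / √det ĝ`
    (∀ (Ω : Set (Euc n)) (X : Euc n → Euc (n + 1)), IsLocalParam ∞ M Ω X → ∀ θ ∈ Ω,
      ρ (x t (X θ)) = volumeRatio X (fun ϑ => x t (X ϑ)) θ) ∧
    -- the weak formulation, tested with `η ∈ H^{1,2}(Γ, ℝⁿ⁺¹)`
    ∀ (η : Euc (n + 1) → Euc (n + 1))
      (gradη : Euc (n + 1) → Matrix (Fin (n + 1)) (Fin (n + 1)) ℝ),
      HasSobolevGrad Γ (ν t) η gradη →
      let Pη : Euc (n + 1) → Euc (n + 1) := fun q => proj (ν t q) (η q)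
      (∃ gradPη, HasSobolevGrad Γ (ν t) Pη gradPη) ∧
      ∀ gradPη : Euc (n + 1) → Matrix (Fin (n + 1)) (Fin (n + 1)) ℝ,
        HasSobolevGrad Γ (ν t) Pη gradPη →
        Integrable (fun q => (α * ρ q) * ⟪ut q, η q⟫) (surf Γ) ∧
        Integrable (fun q => (1 - α * ρ q) * ⟪ut q, ν t q⟫ * ⟪ν t q, η q⟫) (surf Γ) ∧
        Integrable (fun q => dotdot (gradu q) (gradη q)) (surf Γ) ∧
        Integrable (fun q => dotdotWith (H q)⁻¹ (gradu q) (gradPη q) * ρ q) (surf Γ) ∧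
        0 = (∫ q, (α * ρ q) * ⟪ut q, η q⟫ ∂(surf Γ))
          + (∫ q, (1 - α * ρ q) * ⟪ut q, ν t q⟫ * ⟪ν t q, η q⟫ ∂(surf Γ))
          + (∫ q, dotdot (gradu q) (gradη q) ∂(surf Γ))
          + (∫ q, dotdotWith (H q)⁻¹ (gradu q) (gradPη q) * ρ q ∂(surf Γ)) := by
  intro Γ H ρ u ut gradu
  have hy : IsEmbeddingOn 2 M (x t) := hflow.isEmbeddingOn t ht
  have hν : IsUnitNormal Γ (ν t) := hflow.isUnitNormal t ht
  have hN2 : IsHypersurface 2 Γ := hy.isHypersurface_image hM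
  have hN : IsHypersurface 1 Γ := hN2.mono (by norm_num)
  have hc : IsCompact Γ := hMcompact.image_of_continuousOn hy.contDiffOn.continuousOn
  have hρ : ∀ (Ω : Set (Euc n)) (X : Euc n → Euc (n + 1)), IsLocalParam ∞ M Ω X → ∀ θ ∈ Ω,
      ρ (x t (X θ)) = volumeRatio X (fun ϑ => x t (X ϑ)) θ := fun Ω X hX θ hθ =>
    sqrt_det_hMat hM hy hν hX hθ
  refine ⟨hρ, fun η gradη hη => ?_⟩
  intro Pη
  refine ⟨hη.exists_proj hN2 hc hν, fun gradPη hPη => ?_⟩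
  have hfin := isFiniteMeasure_surf hN hc
  -- The left side of the flow equation, carried to the moving surface.
  set a : Euc (n + 1) → Euc (n + 1) := fun q =>
    (α * ρ q) • ut q + (1 - α * ρ q) • (⟪ν t q, ut q⟫ • ν t q) with ha
  obtain ⟨Lg, Lh, hLg, hLh, haL, hparts⟩ := exists_laplacian_fields hM hy hc hν (a := a) (by
    intro Ω X hX θ hθ
    have h1 := hflow.equation t ht Ω X hX θ hθ
    have h2 : ut (x t (X θ)) = derivWithin (fun s => x s (X θ)) (Ico 0 T) t := by
      change derivWithin (fun s => x s (Function.invFunOn (x t) M (x t (X θ)))) (Ico 0 T) t = _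
      rw [hy.invFunOn_apply (hX.mapsTo hθ)]
    simp only [ha]
    rw [hρ Ω X hX θ hθ, h2]
    exact h1)
  have hHc := continuousOn_hMat hM hy hν
  have hρc : ContinuousOn ρ Γ :=
    ((Continuous.matrix_det continuous_id).comp_continuousOn hHc).sqrt
  have hHic : ContinuousOn (fun q => (H q)⁻¹) Γ :=
    continuousOn_inv_matrix hHc fun q hq => (det_hMat_pos hM hy hν hq).ne'
  obtain ⟨i3, j3, e3⟩ := hη.integral_by_parts hN hc hν continuousOn_const continuousOn_const hLg
    fun φ hφ => (hparts φ hφ).1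
  obtain ⟨i4, j4, e4⟩ := hPη.integral_by_parts hN hc hν hHic hρc hLh
    fun φ hφ => (hparts φ hφ).2
  simp only [mul_one, one_mul, ← dotdot_eq_dotdotWith_one] at i3 j3 e3
  -- The velocity is not assumed continuous in space. The field `a` is continuous because the right
  -- side of the equation is, and the integrability of the velocity terms is deduced from it.
  have hac : ContinuousOn a Γ :=
    (hLg.add (hρc.smul (continuousOn_proj hN2 hν hLh))).congr haL
  -- The normal coefficients add up to `αρ + (1 - αρ) = 1`, so `a` and the velocity have the same
  -- normal component.
  have hnormal : ∀ q ∈ Γ, ⟪ν t q, a q⟫ = ⟪ν t q, ut q⟫ := fun q hq => by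
    have h1 : ⟪ν t q, ν t q⟫ = 1 := by rw [real_inner_self_eq_norm_sq, hν.1 q hq, one_pow]
    simp only [ha, inner_add_right, real_inner_smul_right, h1]
    ring
  have hcoef : ContinuousOn (fun q => 1 - α * ρ q) Γ :=
    continuousOn_const.sub (continuousOn_const.mul hρc)
  -- Writing the normal part as `a - P a` shows its continuity without using that of `ν`.
  have hV2 : ContinuousOn (fun q => (1 - α * ρ q) • (a q - proj (ν t q) (a q))) Γ :=
    hcoef.smul (hac.sub (continuousOn_proj hN2 hν hac))
  obtain ⟨φ, -, -, hφη, -⟩ := hη.exists_l2Tendsto hN hc hν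
  have e2 : ∀ q ∈ Γ, ⟪(1 - α * ρ q) • (a q - proj (ν t q) (a q)), η q⟫ =
      (1 - α * ρ q) * ⟪ut q, ν t q⟫ * ⟪ν t q, η q⟫ := fun q hq => by
    rw [proj, sub_sub_cancel, hnormal q hq, real_inner_smul_left, real_inner_smul_left,
      real_inner_comm (ν t q) (ut q), mul_assoc]
  have e1 : ∀ q ∈ Γ, ⟪a q, η q⟫ - (1 - α * ρ q) * ⟪ut q, ν t q⟫ * ⟪ν t q, η q⟫ =
      (α * ρ q) * ⟪ut q, η q⟫ := fun q hq => by
    simp only [ha, inner_add_left, real_inner_smul_left, real_inner_comm (ν t q) (ut q)]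
    ring
  have ia : Integrable (fun q => ⟪a q, η q⟫) (surf Γ) :=
    (l2Tendsto_inner hc hac hφη).memLp.integrable one_le_two
  have i2 : Integrable (fun q => (1 - α * ρ q) * ⟪ut q, ν t q⟫ * ⟪ν t q, η q⟫) (surf Γ) :=
    ((l2Tendsto_inner hc hV2 hφη).memLp.integrable one_le_two).congr
      ((ae_restrict_mem hc.measurableSet).mono e2)
  have i1 : Integrable (fun q => (α * ρ q) * ⟪ut q, η q⟫) (surf Γ) :=
    (ia.sub i2).congr ((ae_restrict_mem hc.measurableSet).mono e1)
  refine ⟨i1, i2, i3, i4, ?_⟩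
  -- The two velocity terms together are `a · η`; by symmetry of `P` the second Laplacian is tested
  -- with `Pη`, as the integration by parts with `Ĥ⁻¹` requires.
  have e12 : (∫ q, (α * ρ q) * ⟪ut q, η q⟫ ∂(surf Γ)) +
      (∫ q, (1 - α * ρ q) * ⟪ut q, ν t q⟫ * ⟪ν t q, η q⟫ ∂(surf Γ)) =
      (∫ q, ⟪Lg q, η q⟫ ∂(surf Γ)) + ∫ q, ρ q * ⟪Lh q, Pη q⟫ ∂(surf Γ) := by
    rw [← integral_add i1 i2, ← integral_add j3 j4]
    refine setIntegral_congr_fun hc.measurableSet fun q hq => ?_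
    have h1 : ⟪a q, η q⟫ = ⟪Lg q, η q⟫ + ρ q * ⟪Lh q, Pη q⟫ := by
      rw [haL q hq, inner_add_left, real_inner_smul_left, inner_proj_left]
    rw [← h1, ← e1 q hq, sub_add_cancel]
  rw [e12]
  change 0 = _ + ∫ q, dotdot (tangGrad Γ (ν t) (fun q => q) q) (gradη q) ∂(surf Γ) +
    ∫ q, dotdotWith (H q)⁻¹ (tangGrad Γ (ν t) (fun q => q) q) (gradPη q) * ρ q ∂(surf Γ)
  linarith
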